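/- All graphs are finite and simple. A non-increasing sequence $\pi=(d_1,\dots,d_n)$ of nonnegative integers is called graphic if it is the degree sequence of a graph $G$ on $n$ vertices; such a $G$ is a realization of $\pi$. It is positive if all $d_i\ge 1$, and $\sigma(\pi)=d_1+\cdots+d_n$. For a graph $H$, let $\sigma(H,n)$ denote the smallest even integer $m$ such that every $n$-term positive graphic sequence $\pi$ with $\sigma(\pi)\ge m$ has a realization containing $H$ as a (not necessarily induced) subgraph. Let $K_6-C_4$ be the graph obtained from the complete graph $K_6$ by removing the edges of a cycle on four of its vertices. Theorem. For every $n\ge 6$, $\sigma(K_6-C_4,n)=6n-10$. Moreover, the $n$-term sequence $((n-1)^3,3^{n-3})$ (three terms equal to $n-1$ followed by $n-3$ terms equal to $3$) is a positive graphic sequence with degree sum $6n-12$, and none of its realizations contains $K_6-C_4$ as a subgraph. -/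

import Mathlib

/-- `G` is a realization of the `n`-term sequence `d`: a simple graph of order `n`, with vertices
labelled so that the `i`-th vertex has degree `d i`. -/
def IsRealization {n : ℕ} (G : SimpleGraph (Fin n)) (d : Fin n → ℕ) : Prop :=
  open Classical in ∀ i, G.degree i = d i

/-- An `n`-term non-increasing sequence of nonnegative integers is graphic if it is the degree
sequence of a simple graph of order `n`. -/
def IsGraphic {n : ℕ} (d : Fin n → ℕ) : Prop :=
  Antitone d ∧ ∃ G : SimpleGraph (Fin n), IsRealization G d

/-- A graphic sequence is potentially `H`-graphic if it has a realization containing `H` as a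
(not necessarily induced) subgraph. -/
def IsPotentiallyGraphic {V : Type*} (H : SimpleGraph V) {n : ℕ} (d : Fin n → ℕ) : Prop :=
  Antitone d ∧ ∃ G : SimpleGraph (Fin n), IsRealization G d ∧ H.IsContained G

/-- `σ(H, n) = m`: `m` is the smallest even integer such that every `n`-term positive graphic
sequence with sum at least `m` has a realization containing `H` as a subgraph. -/
def IsSigma {V : Type*} (H : SimpleGraph V) (n : ℕ) (m : ℤ) : Prop :=
  IsLeast {s : ℤ | Even s ∧ ∀ d : Fin n → ℕ, IsGraphic d → (∀ i, 0 < d i) →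
    s ≤ ((∑ i, d i : ℕ) : ℤ) → IsPotentiallyGraphic H d} m

/-- `K₆ - C₄`: the complete graph on `0, …, 5` with the edges of the 4-cycle on `0, 1, 2, 3`
removed. -/
def K6MinusC4 : SimpleGraph (Fin 6) :=
  (⊤ : SimpleGraph (Fin 6)) \
    (SimpleGraph.cycleGraph 4).map (Fin.castLEEmb (show 4 ≤ 6 by norm_num))

/-- The `n`-term sequence `((n-1)³, 3ⁿ⁻³)`. -/
def extremalSeq (n : ℕ) : Fin n → ℕ :=
  fun i => if (i : ℕ) < 3 then n - 1 else 3

/-!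
Up to isomorphism `K₆ - C₄` is `K₂ ∨ 2K₂`, two copies of `K₄` sharing an edge. The lower bound is the
sequence `((n-1)³, 3ⁿ⁻³)`: in any realization the vertices of degree `3` are independent, whereas
among any three vertices of `K₆ - C₄` two are adjacent.

For the upper bound it is shown that every graph of order `n ≥ 6` with at least `3n - 5` edges shares
its degrees with a graph containing `K₂ ∨ 2K₂`; isolated vertices are allowed. The graphs live on one
fixed vertex type and are supported on a finite set `S`, and the induction is on `|S|`. Order `6` is
a direct count of missing edges. In general a vertex `v` of minimum degree `d` is deleted whenever
enough edges remain. Counting edges leaves only `d = 4` and `d = 5`, with few edges to spare, and then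
`v` is lifted: two disjoint pairs of non-adjacent neighbours of `v` are joined by edges replacing four
edges at `v`. The rest is treated by induction, and `v` is restored by subdividing two disjoint edges
that are not needed for the copy (`potentiallyBook_of_hasLift`). Three points carry this argument.

* After a switch that preserves the degrees, either a copy of `K₂ ∨ 2K₂` is present or such pairs of
  neighbours exist: `reducible_of_deg_eq_four`, if no vertex is adjacent to all others, and
  `reducible_of_deg_eq_five`, for order at least `8`.
* Two edges to subdivide exist, by `hasFreePairs_of_card` and its variants for orders `7` and `8`. For
  `d = 5` and order `8` or `9` the degrees are `5⁸` or `6, 5⁸`, and explicit graphs are used instead.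
* If a vertex is adjacent to all others, it is deleted, and what is wanted is `K₁ ∨ 2K₂` in a graph
  with at least `2n - 2` edges. This is `potentiallyButterfly`, proved by the same method, with a
  single lift at a vertex of degree `3`.
-/

/-! ### Degrees and switches -/

namespace SimpleGraph
open Classical
variable {V : Type*}

/-- The switch of the edges `ab`, `cd` for `ac`, `bd`. -/
def switch (G : SimpleGraph V) (a b c d : V) : SimpleGraph V :=
  ((G \ edge a b) \ edge c d) ⊔ edge a c ⊔ edge b d

theorem switch_adj (G : SimpleGraph V) (a b c d i j : V) :
    (G.switch a b c d).Adj i j ↔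
      (G.Adj i j ∧ ¬ (i = a ∧ j = b) ∧ ¬ (i = b ∧ j = a) ∧ ¬ (i = c ∧ j = d) ∧ ¬ (i = d ∧ j = c)) ∨
      (i ≠ j ∧ (i = a ∧ j = c ∨ i = c ∧ j = a ∨ i = b ∧ j = d ∨ i = d ∧ j = b)) := by
  have hne : G.Adj i j → i ≠ j := fun h => h.ne
  simp only [switch, sup_adj, sdiff_adj, edge_adj]
  grind

variable [Fintype V]

/-- The neighbours of `v`, as a finite set formed with classical decidability. -/
noncomputable def nbs (G : SimpleGraph V) (v : V) : Finset V :=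
  Finset.univ.filter fun w => G.Adj v w

@[simp] theorem mem_nbs {G : SimpleGraph V} {v w : V} : w ∈ G.nbs v ↔ G.Adj v w := by
  simp [nbs]

/-- The degree of `v`, computed with classical decidability. -/
noncomputable def deg (G : SimpleGraph V) (v : V) : ℕ := (G.nbs v).card

/-- Two graphs on the same vertices realize the same degree sequence. -/
def SameDeg (G G' : SimpleGraph V) : Prop := ∀ v, G'.deg v = G.deg v

theorem SameDeg.refl (G : SimpleGraph V) : SameDeg G G := fun _ => rfl

theorem SameDeg.trans {G G' G'' : SimpleGraph V} (h : SameDeg G G') (h' : SameDeg G' G'') :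
    SameDeg G G'' := fun v => (h' v).trans (h v)

theorem deg_add (G : SimpleGraph V) {x y : V} (hxy : x ≠ y) (h : ¬ G.Adj x y) (z : V) :
    (G ⊔ edge x y).deg z = G.deg z + (if z = x then 1 else 0) + (if z = y then 1 else 0) := by
  have hz : (G ⊔ edge x y).nbs z =
      if z = x then insert y (G.nbs z) else if z = y then insert x (G.nbs z) else G.nbs z := by
    ext w
    split_ifs <;> simp [edge_adj] <;> grind
  unfold deg
  rw [hz]
  have h' : ¬ G.Adj y x := fun e => h e.symm
  split_ifs <;> subst_vars <;> simp_all

theorem deg_del (G : SimpleGraph V) {x y : V} (h : G.Adj x y) (z : V) :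
    (G \ edge x y).deg z + (if z = x then 1 else 0) + (if z = y then 1 else 0) = G.deg z := by
  have hne : x ≠ y := h.ne
  have h1 : (G \ edge x y) ⊔ edge x y = G := by
    ext i j
    simp only [sup_adj, sdiff_adj, edge_adj]
    have := h.symm
    grind
  rw [← deg_add (G \ edge x y) hne (by simp [edge_adj, hne]) z, h1]

theorem switch_sameDeg (G : SimpleGraph V) {a b c d : V} (hab : G.Adj a b) (hcd : G.Adj c d)
    (hac : ¬ G.Adj a c) (hbd : ¬ G.Adj b d) (nac : a ≠ c) (nbd : b ≠ d) :
    SameDeg G (G.switch a b c d) := by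
  intro z
  have nad : a ≠ d := fun e => hac (e ▸ hcd.symm)
  have nbc : b ≠ c := fun e => hac (e ▸ hab)
  have nab := hab.ne
  have ncd := hcd.ne
  have h1 := deg_del G hab z
  have h2 := deg_del (G \ edge a b) (x := c) (y := d)
    (by simp only [sdiff_adj, edge_adj]; grind) z
  have h3 := deg_add ((G \ edge a b) \ edge c d) nac
    (by simp only [sdiff_adj, edge_adj]; grind) z
  have h4 := deg_add (((G \ edge a b) \ edge c d) ⊔ edge a c) nbd
    (by simp only [sup_adj, sdiff_adj, edge_adj]; grind) z
  unfold switch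
  omega

end SimpleGraph

/-! ### Vertices of degree four with two non-adjacent neighbours -/

namespace SimpleGraph
open Classical
variable {V : Type*}

/-- `G` contains two copies of `K₄` with exactly one edge `ab`, the spine, in common, that is, a copy
of `K₆ - C₄ = K₂ ∨ 2K₂`. -/
def HasBook (G : SimpleGraph V) : Prop :=
  ∃ a b p q r s, G.Adj a b ∧ G.Adj a p ∧ G.Adj a q ∧ G.Adj a r ∧ G.Adj a s ∧
    G.Adj b p ∧ G.Adj b q ∧ G.Adj b r ∧ G.Adj b s ∧ G.Adj p q ∧ G.Adj r s ∧
    p ≠ r ∧ p ≠ s ∧ q ≠ r ∧ q ≠ s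

/-- The neighbourhood of `v` contains two disjoint pairs of non-adjacent vertices. -/
def HasLift (G : SimpleGraph V) (v : V) : Prop :=
  ∃ x y z w, G.Adj v x ∧ G.Adj v y ∧ G.Adj v z ∧ G.Adj v w ∧ ¬ G.Adj x y ∧ ¬ G.Adj z w ∧
    x ≠ y ∧ z ≠ w ∧ x ≠ z ∧ x ≠ w ∧ y ≠ z ∧ y ≠ w

/-- A clique on five vertices together with a vertex adjacent to three of them contains
`K₆ - C₄`. -/
theorem hasBook_of_clique {G : SimpleGraph V} {p q r s t w : V} (h : G.Adj p q ∧ G.Adj p r ∧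
    G.Adj p s ∧ G.Adj p t ∧ G.Adj q r ∧ G.Adj q s ∧ G.Adj q t ∧ G.Adj r s ∧ G.Adj r t ∧ G.Adj s t)
    (hp : G.Adj w p) (hq : G.Adj w q) (hr : G.Adj w r) (ns : w ≠ s) (nt : w ≠ t) : HasBook G :=
  ⟨p, q, w, r, s, t, by grind [adj_comm, Adj.ne]⟩

/-- The neighbours of `v` are the distinct vertices `a`, `b`, `c`, `d`, where `ad` is not an
edge. -/
structure IsLink (G : SimpleGraph V) (v a b c d : V) : Prop where
  adj_iff : ∀ x, G.Adj v x ↔ x = a ∨ x = b ∨ x = c ∨ x = d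
  not_adj : ¬ G.Adj a d
  ne : a ≠ b ∧ a ≠ c ∧ a ≠ d ∧ b ≠ c ∧ b ≠ d ∧ c ≠ d

namespace IsLink
variable {G : SimpleGraph V} {v a b c d : V}

theorem swap (h : IsLink G v a b c d) : IsLink G v a c b d :=
  ⟨by grind [h.adj_iff], h.not_adj, by grind [h.ne]⟩

theorem symm (h : IsLink G v a b c d) : IsLink G v d b c a :=
  ⟨by grind [h.adj_iff], by grind [h.not_adj, adj_comm], by grind [h.ne]⟩

end IsLink

variable [Fintype V]

/-- Some graph with the degrees of `G` contains `K₆ - C₄` or can be lifted at `v`. -/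
def Reducible (G : SimpleGraph V) (v : V) : Prop :=
  ∃ G', SameDeg G G' ∧ (HasBook G' ∨ HasLift G' v)

theorem Reducible.of_sameDeg {G G' : SimpleGraph V} {v : V} (h : SameDeg G G')
    (h' : Reducible G' v) : Reducible G v := by
  obtain ⟨G'', h1, h2⟩ := h'
  exact ⟨G'', h.trans h1, h2⟩

theorem HasBook.reducible {G : SimpleGraph V} (h : HasBook G) (v : V) : Reducible G v :=
  ⟨G, .refl G, .inl h⟩

theorem HasLift.reducible {G : SimpleGraph V} {v : V} (h : HasLift G v) : Reducible G v :=
  ⟨G, .refl G, .inr h⟩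

/-- A vertex of `G` with more than `T.card` neighbours has a neighbour outside `T`. -/
theorem exists_adj_notMem {G : SimpleGraph V} {x : V} {k : ℕ} (hk : k ≤ G.deg x) {T : Finset V}
    (hT : T.card < k) : ∃ y, G.Adj x y ∧ y ∉ T := by
  obtain ⟨y, hy, hy'⟩ := Finset.exists_mem_notMem_of_card_lt_card (hT.trans_le hk)
  exact ⟨y, mem_nbs.1 hy, hy'⟩

namespace IsLink
variable {G : SimpleGraph V} {v a b c d : V}

/-- A switch of `vb`, `xy` for `vx`, `by` lets `v` be lifted along `ad` and `cx`. -/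
theorem reducible_of_adj (h : IsLink G v a b c d) {x y : V} (hvx : ¬ G.Adj v x) (nvx : v ≠ x)
    (hxc : ¬ G.Adj x c) (hxy : G.Adj x y) (nyb : y ≠ b) (hby : ¬ G.Adj b y) :
    Reducible G v := by
  have h1 := h.adj_iff
  have h2 := h.not_adj
  have h3 := h.ne
  refine .of_sameDeg (switch_sameDeg G (by grind) hxy hvx hby nvx nyb.symm)
    (HasLift.reducible ⟨a, d, c, x, ?_⟩)
  simp only [switch_adj]
  grind [adj_comm, Adj.ne]

theorem adj_of_not_reducible (h : IsLink G v a b c d) (hG : ¬ Reducible G v) : G.Adj b c := by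
  by_contra hbc
  refine hG (HasLift.reducible ⟨a, d, b, c, ?_⟩)
  grind [h.adj_iff, h.not_adj, h.ne]

/-- If a vertex `x` outside missed both `b` and `c`, its neighbours would be common neighbours of `b`
and `c` and adjacent to one another, except perhaps `a` to `d`; then `bc` would be the spine of a copy
of `K₆ - C₄`. -/
theorem adj_or_adj_of_not_reducible (h : IsLink G v a b c d) (hG : ¬ Reducible G v) {x : V}
    (hvx : ¬ G.Adj v x) (nvx : v ≠ x) (hx : 4 ≤ G.deg x) : G.Adj x b ∨ G.Adj x c := by
  by_contra! hxbc
  obtain ⟨hxb, hxc⟩ := hxbc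
  have h1 := h.adj_iff
  have h2 := h.not_adj
  have h3 := h.ne
  have hbc := h.adj_of_not_reducible hG
  have hb : ∀ y, G.Adj x y → G.Adj b y := by
    intro y hxy
    by_contra hby
    exact hG (h.reducible_of_adj hvx nvx hxc hxy (by grind) hby)
  have hc : ∀ y, G.Adj x y → G.Adj c y := by
    intro y hxy
    by_contra hby
    exact hG (h.swap.reducible_of_adj hvx nvx hxb hxy (by grind) hby)
  -- Two neighbours of `x` are adjacent: otherwise joining them by a switch that also creates
  -- the edge `xb` separates `b` from a neighbour of `x`.
  have hy : ∀ y z, G.Adj x y → G.Adj x z → y ≠ z → (y = a ∧ z = d) ∨ (y = d ∧ z = a) ∨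
      G.Adj y z := by
    intro y z hxy hxz hyz
    by_contra! hyz'
    refine hG (.of_sameDeg (switch_sameDeg G (a := y) (b := x) (c := z) (d := b) hxy.symm
      (hb z hxz).symm hyz'.2.2 hxb hyz (by grind)) ?_)
    refine IsLink.reducible_of_adj (a := a) (b := b) (c := c) (d := d) (x := x) (y := z)
      ⟨?_, ?_, h3⟩ ?_ nvx ?_ ?_ ?_ ?_
    all_goals try simp only [switch_adj]
    all_goals grind [adj_comm, Adj.ne]
  obtain ⟨y₁, hy₁, -⟩ := exists_adj_notMem hx (T := ∅) (by simp)
  obtain ⟨y₂, hy₂, n₂⟩ := exists_adj_notMem hx (T := {y₁}) (by simp)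
  obtain ⟨y₃, hy₃, n₃⟩ := exists_adj_notMem hx (T := {y₁, y₂})
    (Finset.card_le_two.trans_lt (by simp))
  obtain ⟨y₄, hy₄, n₄⟩ := exists_adj_notMem hx (T := {y₁, y₂, y₃})
    (Finset.card_le_three.trans_lt (by simp))
  simp only [Finset.mem_insert, Finset.mem_singleton, not_or] at n₂ n₃ n₄
  have h₁₂ := hy y₁ y₂ hy₁ hy₂ (by grind)
  have h₃₄ := hy y₃ y₄ hy₃ hy₄ (by grind)
  have h₁₃ := hy y₁ y₃ hy₁ hy₃ (by grind)
  have h₂₄ := hy y₂ y₄ hy₂ hy₄ (by grind)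
  clear hy
  refine hG (HasBook.reducible ?_ v)
  by_cases hp : G.Adj y₁ y₂ ∧ G.Adj y₃ y₄
  · exact ⟨b, c, y₁, y₂, y₃, y₄, by grind⟩
  · exact ⟨b, c, y₁, y₃, y₂, y₄, by grind⟩

/-- If `x` misses `c` and `t` misses `b`, then every neighbour `y ≠ b` of `x` is adjacent or equal
to every neighbour of `t`: otherwise a switch of `ts`, `by` for `tb`, `sy` separates `b`
from `y`. -/
theorem adj_of_adj_of_adj (h : IsLink G v a b c d) (hG : ¬ Reducible G v) {x t y s : V}
    (hvx : ¬ G.Adj v x) (nvx : v ≠ x) (hxb : G.Adj x b) (hxc : ¬ G.Adj x c) (hvt : ¬ G.Adj v t)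
    (nvt : v ≠ t) (htb : ¬ G.Adj t b) (hxy : G.Adj x y) (nyb : y ≠ b) (hts : G.Adj t s) :
    s = y ∨ G.Adj s y ∨ (s = a ∧ y = d) ∨ (s = d ∧ y = a) := by
  by_contra! hsy
  have h1 := h.adj_iff
  have h2 := h.not_adj
  have h3 := h.ne
  have hby : G.Adj b y := by
    by_contra hby
    exact hG (h.reducible_of_adj hvx nvx hxc hxy nyb hby)
  refine hG (.of_sameDeg (switch_sameDeg G hts hby htb hsy.2.1 (by grind) hsy.1) ?_)
  refine IsLink.reducible_of_adj (a := a) (b := b) (c := c) (d := d) (x := x) (y := y)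
    ⟨?_, ?_, h3⟩ ?_ nvx ?_ ?_ ?_ ?_
  all_goals try simp only [switch_adj]
  all_goals grind [adj_comm, Adj.ne]

/-- If `x` misses `c` and `t` misses `b`, then, unless a switch lets `v` be lifted, the neighbours
of `x` other than `b` and those of `t` other than `c` are common neighbours of `b` and `c`, and any
of the former is adjacent or equal to any of the latter, except perhaps `a` to `d`. These edges
suffice for a copy of `K₆ - C₄`. -/
theorem reducible_of_not_adj_of_not_adj (h : IsLink G v a b c d) {x t : V}
    (hvx : ¬ G.Adj v x) (nvx : v ≠ x) (hxc : ¬ G.Adj x c) (hx : 4 ≤ G.deg x)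
    (hvt : ¬ G.Adj v t) (nvt : v ≠ t) (htb : ¬ G.Adj t b) (ht : 4 ≤ G.deg t) :
    Reducible G v := by
  by_contra hG
  have h1 := h.adj_iff
  have h3 := h.ne
  have hbc := h.adj_of_not_reducible hG
  have hxb := h.adj_or_adj_of_not_reducible hG hvx nvx hx
  have htc := h.adj_or_adj_of_not_reducible hG hvt nvt ht
  simp only [hxc, htb, or_false, false_or] at hxb htc
  have key : ∀ y s, G.Adj x y → y ≠ b → G.Adj t s → s = y ∨ G.Adj s y ∨ (s = a ∧ y = d) ∨
      (s = d ∧ y = a) := fun y s hxy nyb hts =>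
    h.adj_of_adj_of_adj hG hvx nvx hxb hxc hvt nvt htb hxy nyb hts
  have hy : ∀ y, G.Adj x y → y ≠ b → G.Adj b y ∧ G.Adj c y := by
    intro y hxy nyb
    refine ⟨?_, by grind [key y c hxy nyb htc]⟩
    by_contra hby
    exact hG (h.reducible_of_adj hvx nvx hxc hxy nyb hby)
  have hs : ∀ s, G.Adj t s → s ≠ c → G.Adj b s ∧ G.Adj c s := by
    intro s hts nsc
    refine ⟨by grind [h.swap.adj_of_adj_of_adj hG hvt nvt htc htb hvx nvx hxc hts nsc hxb], ?_⟩
    by_contra hcs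
    exact hG (h.swap.reducible_of_adj hvt nvt htb hts nsc hcs)
  obtain ⟨y₁, hy₁, m₁⟩ := exists_adj_notMem hx (T := {b}) (by simp)
  obtain ⟨y₂, hy₂, m₂⟩ := exists_adj_notMem hx (T := {b, y₁})
    (Finset.card_le_two.trans_lt (by simp))
  obtain ⟨y₃, hy₃, m₃⟩ := exists_adj_notMem hx (T := {b, y₁, y₂})
    (Finset.card_le_three.trans_lt (by simp))
  obtain ⟨s₁, hs₁, n₁⟩ := exists_adj_notMem ht (T := {c}) (by simp)
  obtain ⟨s₂, hs₂, n₂⟩ := exists_adj_notMem ht (T := {c, s₁})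
    (Finset.card_le_two.trans_lt (by simp))
  obtain ⟨s₃, hs₃, n₃⟩ := exists_adj_notMem ht (T := {c, s₁, s₂})
    (Finset.card_le_three.trans_lt (by simp))
  simp only [Finset.mem_insert, Finset.mem_singleton, not_or] at m₁ m₂ m₃ n₁ n₂ n₃
  have hbook : ∀ p q r s, G.Adj b p ∧ G.Adj c p → G.Adj b q ∧ G.Adj c q → G.Adj b r ∧ G.Adj c r →
      G.Adj b s ∧ G.Adj c s → G.Adj p q → G.Adj r s → p ≠ r → p ≠ s → q ≠ r → q ≠ s → False :=
    fun p q r s hp hq hr hs hpq hrs e₁ e₂ e₃ e₄ => hG (HasBook.reducible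
      ⟨b, c, p, q, r, s, hbc, hp.1, hq.1, hr.1, hs.1, hp.2, hq.2, hr.2, hs.2, hpq, hrs,
        e₁, e₂, e₃, e₄⟩ v)
  -- If `e ∈ {a, d}` is adjacent to `b` and `c`, then `ve` serves as one of the two edges.
  have hlink : ∀ e, e = a ∨ e = d → G.Adj b e ∧ G.Adj c e → ∀ y s, G.Adj x y → y ≠ b →
      G.Adj t s → s ≠ c → s = y ∨ s = e ∨ y = e := by
    intro e he hbe y s hxy nyb hts nsc
    by_contra! hne
    obtain ⟨hsy, hse, hye⟩ := hne
    refine hbook v e s y ?_ hbe (hs s hts nsc) (hy y hxy nyb) ?_ ?_ ?_ ?_ hse.symm hye.symm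
    · grind [adj_comm]
    · grind
    · grind [key y s hxy nyb hts]
    · grind [adj_comm]
    · grind [adj_comm]
  have hya : ∀ y y', G.Adj x y → y ≠ b → G.Adj x y' → y' ≠ b → y ≠ y' → ¬ (y = a ∨ y = d) := by
    intro y y' hxy nyb hxy' nyb' nyy' e
    have e₁ := hlink y e (hy y hxy nyb) y' s₁ hxy' nyb' hs₁ n₁
    have e₂ := hlink y e (hy y hxy nyb) y' s₂ hxy' nyb' hs₂ n₂.1
    have e₃ := hlink y e (hy y hxy nyb) y' s₃ hxy' nyb' hs₃ n₃.1
    clear hlink hbook key hy hs h1 h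
    grind
  have key' : ∀ y s, G.Adj x y → y ≠ b → ¬ (y = a ∨ y = d) → G.Adj t s → s = y ∨ G.Adj s y := by
    intro y s hxy nyb hya hts
    have := key y s hxy nyb hts
    tauto
  have a₁ := fun s => key' y₁ s hy₁ m₁ (hya y₁ y₂ hy₁ m₁ hy₂ m₂.1 (Ne.symm m₂.2))
  have a₂ := fun s => key' y₂ s hy₂ m₂.1 (hya y₂ y₁ hy₂ m₂.1 hy₁ m₁ m₂.2)
  have a₃ := fun s => key' y₃ s hy₃ m₃.1 (hya y₃ y₁ hy₃ m₃.1 hy₁ m₁ m₃.2.1)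
  have c₁ := hy y₁ hy₁ m₁
  have c₂ := hy y₂ hy₂ m₂.1
  have c₃ := hy y₃ hy₃ m₃.1
  clear key key' hya hlink hy
  have hmem : ∀ s s', G.Adj t s → s ≠ c → G.Adj t s' → s' ≠ c → s ≠ s' →
      s = y₁ ∨ s = y₂ ∨ s = y₃ := by
    intro s s' hts nsc hts' nsc' hss'
    by_contra! hsy
    have d₁ := hs s hts nsc
    have d₂ := hs s' hts' nsc'
    have f₁ := (a₁ s hts).resolve_left hsy.1
    have f₂ := (a₂ s hts).resolve_left hsy.2.1
    have f₃ := (a₃ s hts).resolve_left hsy.2.2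
    have g₁ := a₁ s' hts'
    have g₂ := a₂ s' hts'
    have g₃ := a₃ s' hts'
    by_cases e₁ : s' = y₁
    · exact hbook s y₃ s' y₂ d₁ c₃ d₂ c₂ f₃ (by grind) (by grind) (by grind) (by grind) (by grind)
    by_cases e₂ : s' = y₂
    · exact hbook s y₁ s' y₃ d₁ c₁ d₂ c₃ f₁ (by grind) (by grind) (by grind) (by grind) (by grind)
    · exact hbook s y₁ s' y₂ d₁ c₁ d₂ c₂ f₁ (by grind) (by grind) (by grind) (by grind) (by grind)
  have e₁ := hmem s₁ s₂ hs₁ n₁ hs₂ n₂.1 (Ne.symm n₂.2)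
  have e₂ := hmem s₂ s₁ hs₂ n₂.1 hs₁ n₁ n₂.2
  have e₃ := hmem s₃ s₁ hs₃ n₃.1 hs₁ n₁ n₃.2.1
  have t₁ : G.Adj t y₁ ∧ G.Adj t y₂ ∧ G.Adj t y₃ := by grind
  have k₁₂ := (a₂ y₁ t₁.1).resolve_left (Ne.symm m₂.2)
  have k₁₃ := (a₃ y₁ t₁.1).resolve_left (Ne.symm m₃.2.1)
  have ncx : c ≠ x := by grind
  exact hG (HasBook.reducible ⟨b, y₁, c, y₃, x, y₂, c₁.1, hbc, c₃.1, hxb.symm, c₂.1, c₁.2.symm,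
    k₁₃, hy₁.symm, k₁₂, c₃.2, hy₂, ncx, c₂.2.ne, hy₃.ne', m₃.2.2⟩ v)

/-- If `a` misses `b` and `d`, then `ab` may take the role of `ad`. Unless `v` can be lifted after a
switch, a vertex `x` that misses `c` then has, besides `b` and `d`, a neighbour `y` such that the
cliques `bdvc` and `bdxy` form a copy of `K₆ - C₄`. -/
theorem reducible_of_not_adj_left (h : IsLink G v a b c d) (hab : ¬ G.Adj a b) {x : V}
    (hvx : ¬ G.Adj v x) (nvx : v ≠ x) (hxc : ¬ G.Adj x c) (hx : 4 ≤ G.deg x) :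
    Reducible G v := by
  by_contra hG
  have h1 := h.adj_iff
  have h3 := h.ne
  have hbc := h.adj_of_not_reducible hG
  have hxb := h.adj_or_adj_of_not_reducible hG hvx nvx hx
  have h' : IsLink G v a d c b := ⟨by grind, hab, by grind⟩
  have hdc := h'.adj_of_not_reducible hG
  have hxd := h'.adj_or_adj_of_not_reducible hG hvx nvx hx
  obtain ⟨y, hxy, hy⟩ := exists_adj_notMem hx (T := {b, d})
    (Finset.card_le_two.trans_lt (by simp))
  simp only [Finset.mem_insert, Finset.mem_singleton, not_or] at hy
  have hby : ∀ y, G.Adj x y → y ≠ b → G.Adj b y := by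
    intro y hxy nyb
    by_contra hby
    exact hG (h.reducible_of_adj hvx nvx hxc hxy nyb hby)
  have hdy : ∀ y, G.Adj x y → y ≠ d → G.Adj d y := by
    intro y hxy nyb
    by_contra hby
    exact hG (h'.reducible_of_adj hvx nvx hxc hxy nyb hby)
  have hbd := hdy b (by tauto) h3.2.2.2.2.1
  have hb := hby y hxy hy.1
  have hd := hdy y hxy hy.2
  refine hG (HasBook.reducible ⟨b, d, v, c, x, y, ?_⟩ v)
  clear hby hdy
  grind [adj_comm, Adj.ne]

/-- If `a` misses both `b` and `c`, while all vertices outside `{v, a, b, c, d}` are adjacent to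
both, then either two of those vertices `x`, `y` are adjacent and `b`, `c` are the common vertices
of the cliques `bcvd`, `bcxy`, or they can be made adjacent by a switch. -/
theorem reducible_of_forall_adj (h : IsLink G v a b c d) (hab : ¬ G.Adj a b) (hac : ¬ G.Adj a c)
    {x y : V} (hvx : ¬ G.Adj v x) (nvx : v ≠ x) (hvy : ¬ G.Adj v y) (nvy : v ≠ y) (hxy : x ≠ y)
    (hx : 4 ≤ G.deg x) (hy : 4 ≤ G.deg y)
    (hR : ∀ z, ¬ G.Adj v z → v ≠ z → G.deg z ≠ 0 → G.Adj b z ∧ G.Adj c z) : Reducible G v := by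
  by_contra hG
  have h1 := h.adj_iff
  have h3 := h.ne
  have hbc := h.adj_of_not_reducible hG
  have h₁ : IsLink G v a d c b := ⟨by grind, hab, by grind⟩
  have h₂ : IsLink G v a d b c := ⟨by grind, hac, by grind⟩
  have hdc := h₁.adj_of_not_reducible hG
  have hdb := h₂.adj_of_not_reducible hG
  have hind : ∀ z w, ¬ G.Adj v z → v ≠ z → G.Adj z w → w = a ∨ w = b ∨ w = c ∨ w = d := by
    intro z w hvz nvz hzw
    by_contra! hw
    have hz : G.deg z ≠ 0 := Finset.card_ne_zero.2 ⟨w, mem_nbs.2 hzw⟩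
    have hw' : G.deg w ≠ 0 := Finset.card_ne_zero.2 ⟨z, mem_nbs.2 hzw.symm⟩
    have hvw : ¬ G.Adj v w := by grind
    have nvw : v ≠ w := fun e => hvz (e ▸ hzw.symm)
    have r₁ := hR z hvz nvz hz
    have r₂ := hR w hvw nvw hw'
    refine hG (HasBook.reducible ⟨b, c, v, d, z, w, ?_⟩ v)
    grind [adj_comm, Adj.ne]
  have hall : ∀ z, ¬ G.Adj v z → v ≠ z → 4 ≤ G.deg z →
      G.Adj z a ∧ G.Adj z b ∧ G.Adj z c ∧ G.Adj z d := by
    intro z hvz nvz hz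
    have key : ∀ p q r s, (∀ w, G.Adj z w → w = p ∨ w = q ∨ w = r ∨ w = s) → G.Adj z s := by
      intro p q r s hs
      obtain ⟨w, hw, hw'⟩ := exists_adj_notMem hz (T := {p, q, r})
        (Finset.card_le_three.trans_lt (by simp))
      simp only [Finset.mem_insert, Finset.mem_singleton, not_or] at hw'
      have := hs w hw
      grind
    have := fun w => hind z w hvz nvz
    exact ⟨key b c d a (by grind), key a c d b (by grind), key a b d c (by grind),
      key a b c d (by grind)⟩
  have hax := hall x hvx nvx hx
  have hay := hall y hvy nvy hy
  have hnxy : ¬ G.Adj x y := by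
    have := hind x y hvx nvx
    grind
  clear hall hind hR
  refine hG (.of_sameDeg (switch_sameDeg G hax.1 hay.2.1 hnxy hab hxy h3.1)
    (HasBook.reducible ⟨c, d, x, y, v, b, ?_⟩ v))
  simp only [switch_adj]
  grind [adj_comm, Adj.ne]

/-- A vertex `v` of degree `4`, not all of whose neighbours are adjacent, is reducible if no vertex
is adjacent to all others. -/
theorem reducible (h : IsLink G v a b c d) {S : Finset V} (hS : ∀ x y, G.Adj x y → x ∈ S)
    (hmin : ∀ x ∈ S, 4 ≤ G.deg x) (hcard : 7 ≤ S.card)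
    (hdom : ∀ x ∈ S, ∃ y ∈ S, x ≠ y ∧ ¬ G.Adj x y) : Reducible G v := by
  by_contra hG
  have h1 := h.adj_iff
  have h3 := h.ne
  have hbc := h.adj_of_not_reducible hG
  obtain ⟨t, htS, nbt, hbt⟩ := hdom b (hS b c hbc)
  obtain ⟨x, hxS, ncx, hcx⟩ := hdom c (hS c b hbc.symm)
  have ht := hmin t htS
  have hx := hmin x hxS
  have nvt : v ≠ t := by grind [adj_comm]
  have nvx : v ≠ x := by grind [adj_comm]
  have htb : ¬ G.Adj t b := fun e => hbt e.symm
  have hxc : ¬ G.Adj x c := fun e => hcx e.symm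
  have heq : ∀ {a b c d : V}, IsLink G v a b c d → ¬ G.Adj a b → ¬ G.Adj a c → False := by
    intro a b c d h hab hac
    have hR : ∀ z, ¬ G.Adj v z → v ≠ z → G.deg z ≠ 0 → G.Adj b z ∧ G.Adj c z := by
      intro z hvz nvz hz
      obtain ⟨w, hw⟩ := Finset.card_ne_zero.1 hz
      have hz' := hmin z (hS z w (mem_nbs.1 hw))
      constructor
      · by_contra hbz
        exact hG (h.swap.reducible_of_not_adj_left hac hvz nvz (fun e => hbz e.symm) hz')
      · by_contra hcz
        exact hG (h.reducible_of_not_adj_left hab hvz nvz (fun e => hcz e.symm) hz')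
    have h1 := h.adj_iff
    have hcard' : ({v, a, b, c, d} : Finset V).card ≤ 5 := Finset.card_le_five
    obtain ⟨x, hxS, hx⟩ := Finset.exists_mem_notMem_of_card_lt_card
      (s := {v, a, b, c, d}) (t := S) (by omega)
    have hcard'' := Finset.card_insert_le x {v, a, b, c, d}
    obtain ⟨y, hyS, hy⟩ := Finset.exists_mem_notMem_of_card_lt_card
      (s := insert x {v, a, b, c, d}) (t := S) (by omega)
    simp only [Finset.mem_insert, Finset.mem_singleton, not_or] at hx hy
    exact hG (h.reducible_of_forall_adj hab hac (x := x) (y := y) (by grind) (by grind) (by grind)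
      (by grind) (by grind) (hmin x hxS) (hmin y hyS) hR)
  have hlift : ¬ HasLift G v := fun e => hG e.reducible
  by_cases hvt : G.Adj v t <;> by_cases hvx : G.Adj v x
  · have ht' : t = a ∨ t = d := by grind
    have hx' : x = a ∨ x = d := by grind
    by_cases htx : t = x
    · subst htx
      rcases ht' with rfl | rfl
      · exact heq h htb hxc
      · exact heq h.symm htb hxc
    · exact hlift ⟨t, b, x, c, by grind⟩
  · rcases (show t = a ∨ t = d by grind) with rfl | rfl
    · exact hG (h.reducible_of_not_adj_left htb hvx nvx hxc hx)
    · exact hG (h.symm.reducible_of_not_adj_left htb hvx nvx hxc hx)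
  · rcases (show x = a ∨ x = d by grind) with rfl | rfl
    · exact hG (h.swap.reducible_of_not_adj_left hxc hvt nvt htb ht)
    · exact hG (h.symm.swap.reducible_of_not_adj_left hxc hvt nvt htb ht)
  · exact hG (h.reducible_of_not_adj_of_not_adj hvx nvx hxc hx hvt nvt htb ht)

end IsLink

end SimpleGraph

/-! ### Vertices of degree four -/

namespace SimpleGraph
open Classical
variable {V : Type*} [Fintype V]

theorem mem_of_deg_ne_zero {G : SimpleGraph V} {S : Finset V} (hS : ∀ x ∉ S, G.deg x = 0)
    {x y : V} (h : G.Adj x y) : x ∈ S := by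
  by_contra hx
  exact Finset.card_ne_zero.2 ⟨y, mem_nbs.2 h⟩ (hS x hx)

theorem exists_not_adj {G : SimpleGraph V} {S : Finset V} (hS : ∀ x ∉ S, G.deg x = 0)
    {x : V} (hx : x ∈ S) (hd : G.deg x + 1 ≠ S.card) : ∃ y ∈ S, x ≠ y ∧ ¬ G.Adj x y := by
  by_contra! h
  apply hd
  have : G.nbs x = S.erase x := by
    ext y
    rw [mem_nbs, Finset.mem_erase]
    exact ⟨fun e => ⟨e.ne', mem_of_deg_ne_zero hS e.symm⟩, fun e => h y e.2 e.1.symm⟩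
  rw [deg, this]
  exact Finset.card_erase_add_one hx

theorem exists_nbs_four {G : SimpleGraph V} {v : V} (h : G.deg v = 4) :
    ∃ a b c d, (∀ x, G.Adj v x ↔ x = a ∨ x = b ∨ x = c ∨ x = d) ∧
      a ≠ b ∧ a ≠ c ∧ a ≠ d ∧ b ≠ c ∧ b ≠ d ∧ c ≠ d := by
  obtain ⟨a, T, ha, hT, hT'⟩ := Finset.card_eq_succ.1 h
  obtain ⟨b, c, d, hbc, hbd, hcd, rfl⟩ := Finset.card_eq_three.1 hT'
  refine ⟨a, b, c, d, fun x => ?_, ?_⟩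
  · rw [← mem_nbs, ← hT]
    simp
  · grind

theorem exists_nbs_five {G : SimpleGraph V} {v : V} (h : G.deg v = 5) :
    ∃ a b c d e, (∀ x, G.Adj v x ↔ x = a ∨ x = b ∨ x = c ∨ x = d ∨ x = e) ∧
      a ≠ b ∧ a ≠ c ∧ a ≠ d ∧ a ≠ e ∧ b ≠ c ∧ b ≠ d ∧ b ≠ e ∧ c ≠ d ∧ c ≠ e ∧ d ≠ e := by
  obtain ⟨a, T, ha, hT, hT'⟩ := Finset.card_eq_succ.1 h
  obtain ⟨b, U, hb, hU, hU'⟩ := Finset.card_eq_succ.1 hT'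
  obtain ⟨c, d, e, hcd, hce, hde, rfl⟩ := Finset.card_eq_three.1 hU'
  refine ⟨a, b, c, d, e, fun x => ?_, ?_⟩
  · rw [← mem_nbs, ← hT, ← hU]
    simp
  · subst hU
    grind

/-- If `G` has no copy of `K₆ - C₄`, a vertex `x` outside a clique `vu₁u₂u₃u₄` misses at least two
of `u₁`, `u₂`, `u₃`, `u₄`. -/
theorem exists_not_adj_of_clique {G : SimpleGraph V} (hG : ¬ HasBook G) {v u₁ u₂ u₃ u₄ x : V}
    (hv : G.Adj v u₁ ∧ G.Adj v u₂ ∧ G.Adj v u₃ ∧ G.Adj v u₄)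
    (h : G.Adj u₁ u₂ ∧ G.Adj u₁ u₃ ∧ G.Adj u₁ u₄ ∧ G.Adj u₂ u₃ ∧ G.Adj u₂ u₄ ∧ G.Adj u₃ u₄)
    (nxv : x ≠ v) (hne : x ≠ u₁ ∧ x ≠ u₂ ∧ x ≠ u₃ ∧ x ≠ u₄) (n : V) :
    ∃ n', (n' = u₁ ∨ n' = u₂ ∨ n' = u₃ ∨ n' = u₄) ∧ n' ≠ n ∧ ¬ G.Adj x n' := by
  obtain ⟨v₁, v₂, v₃, v₄⟩ := hv
  obtain ⟨h₁₂, h₁₃, h₁₄, h₂₃, h₂₄, h₃₄⟩ := h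
  obtain ⟨n₁, n₂, n₃, n₄⟩ := hne
  have key : ∀ p q r s, G.Adj v p → G.Adj v q → G.Adj v r → G.Adj v s → G.Adj p q → G.Adj p r →
      G.Adj p s → G.Adj q r → G.Adj q s → G.Adj r s → x ≠ s →
      G.Adj x p → G.Adj x q → ¬ G.Adj x r := by
    intro p q r s hp hq hr hs _ _ _ _ _ _ ns xp xq xr
    have hp' := hp.symm
    have hq' := hq.symm
    have hr' := hr.symm
    have hs' := hs.symm
    exact hG (hasBook_of_clique (by and_intros <;> assumption) xp xq xr ns nxv)
  have k₁ := key u₁ u₂ u₃ u₄ v₁ v₂ v₃ v₄ h₁₂ h₁₃ h₁₄ h₂₃ h₂₄ h₃₄ n₄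
  have k₂ := key u₁ u₂ u₄ u₃ v₁ v₂ v₄ v₃ h₁₂ h₁₄ h₁₃ h₂₄ h₂₃ h₃₄.symm n₃
  have k₃ := key u₁ u₃ u₄ u₂ v₁ v₃ v₄ v₂ h₁₃ h₁₄ h₁₂ h₃₄ h₂₃.symm h₂₄.symm n₂
  have k₄ := key u₂ u₃ u₄ u₁ v₂ v₃ v₄ v₁ h₂₃ h₂₄ h₁₂.symm h₃₄ h₁₃.symm h₁₄.symm n₁
  by_contra! h
  have ha := h u₁ (by simp)
  have hb := h u₂ (by simp)
  have hc := h u₃ (by simp)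
  have hd := h u₄ (by simp)
  by_cases na : u₁ = n
  · subst na
    exact k₄ (hb h₁₂.ne') (hc h₁₃.ne') (hd h₁₄.ne')
  by_cases nb : u₂ = n
  · subst nb
    exact k₃ (ha na) (hc h₂₃.ne') (hd h₂₄.ne')
  by_cases nc : u₃ = n
  · subst nc
    exact k₂ (ha na) (hb nb) (hd h₃₄.ne')
  · exact k₁ (ha na) (hb nb) (hc nc)

/-- A clique formed by the neighbours of `v` is broken by a switch of `vn`, `xy` for `vx`, `ny`, with
an edge `xy` outside: then `x` is a neighbour of `v` that misses another neighbour `n'`. -/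
theorem reducible_of_deg_eq_four {G : SimpleGraph V} {S : Finset V} (hS : ∀ x ∉ S, G.deg x = 0)
    (hmin : ∀ x ∈ S, 4 ≤ G.deg x) (hcard : 7 ≤ S.card) (hdom : ∀ x ∈ S, G.deg x + 1 ≠ S.card)
    {v : V} (hv : G.deg v = 4) : Reducible G v := by
  have hlink : ∀ {G' : SimpleGraph V} {a b c d : V}, SameDeg G G' → IsLink G' v a b c d →
      Reducible G v := by
    intro G' a b c d hG' h
    have hS' : ∀ x ∉ S, G'.deg x = 0 := fun x hx => (hG' x).trans (hS x hx)
    exact .of_sameDeg hG' (h.reducible (fun x y e => mem_of_deg_ne_zero hS' e)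
      (fun x hx => (hG' x).symm ▸ hmin x hx) hcard
      fun x hx => exists_not_adj hS' hx ((hG' x).symm ▸ hdom x hx))
  obtain ⟨a, b, c, d, hv', hne⟩ := exists_nbs_four hv
  by_cases had : G.Adj a d
  swap
  · exact hlink (.refl G) (a := a) (b := b) (c := c) (d := d) ⟨hv', had, hne⟩
  by_cases hab : G.Adj a b
  swap
  · exact hlink (.refl G) (a := a) (b := d) (c := c) (d := b) ⟨by grind, hab, by grind⟩
  by_cases hac : G.Adj a c
  swap
  · exact hlink (.refl G) (a := a) (b := b) (c := d) (d := c) ⟨by grind, hac, by grind⟩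
  by_cases hbc : G.Adj b c
  swap
  · exact hlink (.refl G) (a := b) (b := a) (c := d) (d := c) ⟨by grind, hbc, by grind⟩
  by_cases hbd : G.Adj b d
  swap
  · exact hlink (.refl G) (a := b) (b := a) (c := c) (d := d) ⟨by grind, hbd, by grind⟩
  by_cases hcd : G.Adj c d
  swap
  · exact hlink (.refl G) (a := c) (b := b) (c := a) (d := d) ⟨by grind, hcd, by grind⟩
  by_contra hG
  have hout : ∀ x, ¬ G.Adj v x → v ≠ x → ∀ n, ∃ n', (n' = a ∨ n' = b ∨ n' = c ∨ n' = d) ∧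
      n' ≠ n ∧ ¬ G.Adj x n' := by
    intro x hvx nvx n
    refine exists_not_adj_of_clique (fun e => hG (e.reducible v)) (by simp [hv'])
      ⟨hab, hac, had, hbc, hbd, hcd⟩ nvx.symm ?_ n
    simpa only [hv', not_or] using hvx
  obtain ⟨x, hxS, hx⟩ := Finset.exists_mem_notMem_of_card_lt_card
    (s := {v, a, b, c, d}) (t := S) (Finset.card_le_five.trans_lt (by omega))
  simp only [Finset.mem_insert, Finset.mem_singleton, not_or] at hx
  have hvx : ¬ G.Adj v x := by grind
  have nvx : v ≠ x := by grind
  obtain ⟨m, hm, -, hxm⟩ := hout x hvx nvx v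
  -- The neighbours of `x` do not all lie in `{a, b, c, d}`, since `m` is missing.
  obtain ⟨y, hxy, hy⟩ : ∃ y, G.Adj x y ∧ ¬ G.Adj v y := by
    by_contra! h
    have hsub : G.nbs x ⊆ ({a, b, c, d} : Finset V).erase m := by
      intro y hy
      rw [mem_nbs] at hy
      have := h y hy
      rw [Finset.mem_erase]
      simp only [Finset.mem_insert, Finset.mem_singleton]
      grind
    have h1 := Finset.card_le_card hsub
    have h2 : m ∈ ({a, b, c, d} : Finset V) := by simpa using hm
    have h3 := Finset.card_erase_add_one h2
    have h4 : ({a, b, c, d} : Finset V).card ≤ 4 := Finset.card_le_four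
    have h5 := hmin x hxS
    unfold deg at h5
    omega
  have nvy : v ≠ y := fun e => hvx (e ▸ hxy.symm)
  obtain ⟨n, hn, -, hyn⟩ := hout y hy nvy v
  obtain ⟨n', hn', nnn', hxn'⟩ := hout x hvx nvx n
  have hsw := switch_sameDeg G (a := v) (b := n) (c := x) (d := y) ((hv' n).2 hn) hxy hvx
    (fun e => hyn e.symm) nvx (by grind)
  -- After the switch the neighbours of `v` are `n'`, `k`, `l`, `x`.
  obtain ⟨k, l, nkl, hkl⟩ : ∃ k l, k ≠ l ∧ ((G.nbs v).erase n).erase n' = {k, l} := by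
    refine Finset.card_eq_two.1 ?_
    rw [Finset.card_erase_of_mem, Finset.card_erase_of_mem, show (G.nbs v).card = 4 from hv]
    · exact mem_nbs.2 ((hv' n).2 hn)
    · exact Finset.mem_erase.2 ⟨nnn', mem_nbs.2 ((hv' n').2 hn')⟩
  have hkl' : ∀ z, z ≠ n' ∧ z ≠ n ∧ G.Adj v z ↔ z = k ∨ z = l := by
    intro z
    rw [← mem_nbs, ← Finset.mem_erase, ← Finset.mem_erase, hkl]
    simp
  have hk := (hkl' k).2 (.inl rfl)
  have hl := (hkl' l).2 (.inr rfl)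
  have hvn := (hv' n).2 hn
  have hvn' := (hv' n').2 hn'
  clear hout hv'
  refine hG (hlink hsw (a := n') (b := k) (c := l) (d := x) ⟨?_, ?_, ?_⟩)
  all_goals try simp only [switch_adj]
  · intro z
    have hz := hkl' z
    have nvn := hvn.ne
    have hnx : n ≠ x := fun e => hvx (e ▸ hvn)
    by_cases hzx : z = x
    · subst hzx
      simp [nvx]
    · by_cases hzn : z = n
      · subst hzn
        have := nnn'.symm
        grind
      · by_cases hzn' : z = n'
        · subst hzn'
          have := hvn'.ne
          grind
        · have : v ≠ z → z ≠ y ∨ v ≠ n := fun _ => .inr nvn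
          grind
  · grind [adj_comm, Adj.ne]
  · grind

end SimpleGraph

/-! ### Vertices of degree five -/

namespace SimpleGraph
open Classical
variable {V : Type*} [Fintype V]

theorem exists_adj_not_adj {G : SimpleGraph V} {v x a b c d e : V}
    (hv : ∀ z, G.Adj v z ↔ z = a ∨ z = b ∨ z = c ∨ z = d ∨ z = e) (hx : 5 ≤ G.deg x)
    (h : ∃ z, G.Adj v z ∧ ¬ G.Adj x z) : ∃ y, G.Adj x y ∧ ¬ G.Adj v y := by
  by_contra! hxy
  obtain ⟨z, hz, hz'⟩ := h
  have hss : G.nbs x ⊂ {a, b, c, d, e} := by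
    refine Finset.ssubset_iff_subset_ne.2 ⟨fun y hy => ?_, fun heq => hz' ?_⟩
    · simpa using (hv y).1 (hxy y (mem_nbs.1 hy))
    · rw [← mem_nbs, heq]
      simpa using (hv z).1 hz
  have h1 := Finset.card_lt_card hss
  have h2 : ({a, b, c, d, e} : Finset V).card ≤ 5 := Finset.card_le_five
  unfold deg at hx
  omega

/-- If `c` is adjacent to `v` and `G` has no copy of `K₆ - C₄`, then `c` is adjacent to at most one
of `u₁`, `u₂`, `u₃`, `u₄` when these form a clique with `v`. -/
theorem exists_not_adj_of_adj {G : SimpleGraph V} (hG : ¬ HasBook G) {v u₁ u₂ u₃ u₄ c : V}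
    (hv : G.Adj v u₁ ∧ G.Adj v u₂ ∧ G.Adj v u₃ ∧ G.Adj v u₄)
    (h : G.Adj u₁ u₂ ∧ G.Adj u₁ u₃ ∧ G.Adj u₁ u₄ ∧ G.Adj u₂ u₃ ∧ G.Adj u₂ u₄ ∧ G.Adj u₃ u₄)
    (hc : G.Adj c v) (hne : c ≠ u₁ ∧ c ≠ u₂ ∧ c ≠ u₃ ∧ c ≠ u₄) (n n' : V) :
    ∃ m, (m = u₁ ∨ m = u₂ ∨ m = u₃ ∨ m = u₄) ∧ m ≠ n ∧ m ≠ n' ∧ ¬ G.Adj c m := by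
  obtain ⟨v₁, v₂, v₃, v₄⟩ := hv
  obtain ⟨h₁₂, h₁₃, h₁₄, h₂₃, h₂₄, h₃₄⟩ := h
  obtain ⟨n₁, n₂, n₃, n₄⟩ := hne
  have key : ∀ q r s t, G.Adj v q → G.Adj v r → G.Adj v s → G.Adj v t → G.Adj q r → G.Adj q s →
      G.Adj q t → G.Adj r s → G.Adj r t → G.Adj s t → c ≠ s → c ≠ t → G.Adj c q → ¬ G.Adj c r :=
    fun q r s t _ _ _ _ _ _ _ _ _ _ ns nt hq hr =>
      hG (hasBook_of_clique (by and_intros <;> assumption) hc hq hr ns nt)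
  have k₁₂ := key u₁ u₂ u₃ u₄ v₁ v₂ v₃ v₄ h₁₂ h₁₃ h₁₄ h₂₃ h₂₄ h₃₄ n₃ n₄
  have k₁₃ := key u₁ u₃ u₂ u₄ v₁ v₃ v₂ v₄ h₁₃ h₁₂ h₁₄ h₂₃.symm h₃₄ h₂₄ n₂ n₄
  have k₁₄ := key u₁ u₄ u₂ u₃ v₁ v₄ v₂ v₃ h₁₄ h₁₂ h₁₃ h₂₄.symm h₃₄.symm h₂₃ n₂ n₃
  have k₂₃ := key u₂ u₃ u₁ u₄ v₂ v₃ v₁ v₄ h₂₃ h₁₂.symm h₂₄ h₁₃.symm h₃₄ h₁₄ n₁ n₄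
  have k₂₄ := key u₂ u₄ u₁ u₃ v₂ v₄ v₁ v₃ h₂₄ h₁₂.symm h₂₃ h₁₄.symm h₃₄.symm h₁₃ n₁ n₃
  have k₃₄ := key u₃ u₄ u₁ u₂ v₃ v₄ v₁ v₂ h₃₄ h₁₃.symm h₂₃.symm h₁₄.symm h₂₄.symm h₁₂ n₁ n₂
  by_contra! h
  have ha := h u₁ (by simp)
  have hb := h u₂ (by simp)
  have hc := h u₃ (by simp)
  have hd := h u₄ (by simp)
  have three : ∀ i j k : V, i ≠ j → i ≠ k → j ≠ k →
      (i ≠ n ∧ i ≠ n') ∨ (j ≠ n ∧ j ≠ n') ∨ (k ≠ n ∧ k ≠ n') := by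
    clear * -
    grind
  have t₁ := three u₁ u₂ u₃ h₁₂.ne h₁₃.ne h₂₃.ne
  have t₂ := three u₁ u₂ u₄ h₁₂.ne h₁₄.ne h₂₄.ne
  have t₃ := three u₁ u₃ u₄ h₁₃.ne h₁₄.ne h₃₄.ne
  have t₄ := three u₂ u₃ u₄ h₂₃.ne h₂₄.ne h₃₄.ne
  clear three key h hG v₁ v₂ v₃ v₄ h₁₂ h₁₃ h₁₄ h₂₃ h₂₄ h₃₄ n₁ n₂ n₃ n₄
  by_cases f₁ : u₁ ≠ n ∧ u₁ ≠ n' <;> by_cases f₂ : u₂ ≠ n ∧ u₂ ≠ n' <;>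
    by_cases f₃ : u₃ ≠ n ∧ u₃ ≠ n' <;> by_cases f₄ : u₄ ≠ n ∧ u₄ ≠ n' <;> simp_all

/-- A vertex of degree `5` whose neighbours are `c` and a clique `u₁u₂u₃u₄` is reducible: if `c` or
a vertex `x` outside has three neighbours in the clique `vu₁u₂u₃u₄`, there is a copy of `K₆ - C₄`;
otherwise a switch exchanges some `uᵢ` for `x` in the neighbourhood of `v`. -/
theorem reducible_of_star {G : SimpleGraph V} {S : Finset V} (hmin : ∀ x ∈ S, 5 ≤ G.deg x)
    (hcard : 8 ≤ S.card) {v c u₁ u₂ u₃ u₄ : V}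
    (hv : ∀ z, G.Adj v z ↔ z = c ∨ z = u₁ ∨ z = u₂ ∨ z = u₃ ∨ z = u₄)
    (hne : c ≠ u₁ ∧ c ≠ u₂ ∧ c ≠ u₃ ∧ c ≠ u₄)
    (h : G.Adj u₁ u₂ ∧ G.Adj u₁ u₃ ∧ G.Adj u₁ u₄ ∧ G.Adj u₂ u₃ ∧ G.Adj u₂ u₄ ∧ G.Adj u₃ u₄) :
    Reducible G v := by
  by_contra hG
  have hB : ¬ HasBook G := fun e => hG (e.reducible v)
  have hvc := (hv c).2 (by simp)
  have hvu := And.intro ((hv u₁).2 (by simp)) (And.intro ((hv u₂).2 (by simp))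
    (And.intro ((hv u₃).2 (by simp)) ((hv u₄).2 (by simp))))
  have hout : ∀ x, v ≠ x → ¬ G.Adj v x → ∀ n, ∃ n',
      (n' = u₁ ∨ n' = u₂ ∨ n' = u₃ ∨ n' = u₄) ∧ n' ≠ n ∧ ¬ G.Adj x n' := by
    intro x nvx hvx n
    refine exists_not_adj_of_clique hB hvu h nvx.symm ?_ n
    simp only [hv, not_or] at hvx
    exact hvx.2
  have hcout := exists_not_adj_of_adj hB hvu h hvc.symm hne
  obtain ⟨x, hxS, hx⟩ := Finset.exists_mem_notMem_of_card_lt_card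
    (s := {v, c, u₁, u₂, u₃, u₄}) (t := S) (Finset.card_le_six.trans_lt (by omega))
  simp only [Finset.mem_insert, Finset.mem_singleton, not_or] at hx
  have hvx : ¬ G.Adj v x := by
    rw [hv]
    tauto
  have nvx : v ≠ x := hx.1 ∘ Eq.symm
  obtain ⟨m, hm, -, hxm⟩ := hout x nvx hvx v
  obtain ⟨y, hxy, hy⟩ := exists_adj_not_adj hv (hmin x hxS) ⟨m, (hv m).2 (.inr hm), hxm⟩
  have nvy : v ≠ y := fun e => hvx (e ▸ hxy.symm)
  obtain ⟨n, hn, -, hyn⟩ := hout y nvy hy v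
  obtain ⟨n', hn', nnn', hxn'⟩ := hout x nvx hvx n
  obtain ⟨k, hk, nkn, nkn', hck⟩ := hcout n n'
  have hvn := (hv n).2 (.inr hn)
  have hvn' := (hv n').2 (.inr hn')
  have hvk := (hv k).2 (.inr hk)
  have hcu : ∀ i, (i = u₁ ∨ i = u₂ ∨ i = u₃ ∨ i = u₄) → c ≠ i := by
    rintro i (rfl | rfl | rfl | rfl)
    exacts [hne.1, hne.2.1, hne.2.2.1, hne.2.2.2]
  have ncn := hcu n hn
  have ncn' := hcu n' hn'
  have nck := hcu k hk
  refine hG (.of_sameDeg (switch_sameDeg G (a := v) (b := n) (c := x) (d := y) hvn hxy hvx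
    (fun e => hyn e.symm) nvx (fun e => hy (e ▸ hvn))) (HasLift.reducible ⟨c, k, x, n', ?_⟩))
  clear hout hcout hcu hn hn' hk hne hv hvu h hm hxm hx hB hmin
  simp only [switch_adj]
  grind [adj_comm, Adj.ne]

/-- A vertex of degree `5` is reducible if its neighbours are three independent vertices `p`, `q`,
`r` and two further vertices `s`, `t` adjacent to each other and to `p`, `q`, `r`. -/
theorem reducible_of_triangle {G : SimpleGraph V} {S : Finset V} (hmin : ∀ x ∈ S, 5 ≤ G.deg x)
    (hcard : 8 ≤ S.card) {v p q r s t : V}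
    (hv : ∀ z, G.Adj v z ↔ z = p ∨ z = q ∨ z = r ∨ z = s ∨ z = t)
    (hne : p ≠ q ∧ p ≠ r ∧ q ≠ r)
    (hn : ¬ G.Adj p q ∧ ¬ G.Adj p r ∧ ¬ G.Adj q r)
    (h : G.Adj s t ∧ G.Adj s p ∧ G.Adj s q ∧ G.Adj s r ∧ G.Adj t p ∧ G.Adj t q ∧ G.Adj t r) :
    Reducible G v := by
  by_contra hG
  have hvp := (hv p).2 (by simp)
  have hvq := (hv q).2 (by simp)
  have hvr := (hv r).2 (by simp)
  have hvs := (hv s).2 (by simp)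
  have hvt := (hv t).2 (by simp)
  have hB : ¬ HasBook G := fun e => hG (e.reducible v)
  have hL : ∀ {n x y : V}, G.Adj v n → ¬ G.Adj v x → v ≠ x → G.Adj x y → ¬ G.Adj n y → n ≠ y →
      ¬ HasLift (G.switch v n x y) v := fun h₁ h₂ h₃ h₄ h₅ h₆ e =>
    hG (.of_sameDeg (switch_sameDeg G h₁ h₄ h₂ h₅ h₃ h₆) e.reducible)
  -- A vertex outside adjacent to `s` and `t` is adjacent to none of `p`, `q`, `r`.
  have hst : ∀ x, ¬ G.Adj v x → v ≠ x → G.Adj x s → G.Adj x t →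
      ¬ G.Adj x p ∧ ¬ G.Adj x q ∧ ¬ G.Adj x r := by
    intro x hvx nvx hxs hxt
    refine ⟨fun e => hB ⟨s, t, v, q, x, p, ?_⟩, fun e => hB ⟨s, t, v, p, x, q, ?_⟩,
      fun e => hB ⟨s, t, v, p, x, r, ?_⟩⟩ <;> grind [adj_comm, Adj.ne]
  have hs : ∀ x y, ¬ G.Adj v x → v ≠ x → ¬ G.Adj v y → v ≠ y → G.Adj x y → ¬ G.Adj s y →
      G.Adj x p ∧ G.Adj x t := by
    intro x y hvx nvx hvy nvy hxy hsy
    refine ⟨?_, ?_⟩ <;> by_contra hc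
    · refine hL hvs hvx nvx hxy hsy (by grind) ⟨p, x, q, r, ?_⟩
      simp only [switch_adj]
      grind [adj_comm, Adj.ne]
    · refine hL hvs hvx nvx hxy hsy (by grind) ⟨t, x, q, r, ?_⟩
      simp only [switch_adj]
      grind [adj_comm, Adj.ne]
  have ht : ∀ x y, ¬ G.Adj v x → v ≠ x → ¬ G.Adj v y → v ≠ y → G.Adj x y → ¬ G.Adj t y →
      G.Adj x p ∧ G.Adj x s := by
    intro x y hvx nvx hvy nvy hxy hsy
    refine ⟨?_, ?_⟩ <;> by_contra hc
    · refine hL hvt hvx nvx hxy hsy (by grind) ⟨p, x, q, r, ?_⟩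
      simp only [switch_adj]
      grind [adj_comm, Adj.ne]
    · refine hL hvt hvx nvx hxy hsy (by grind) ⟨s, x, q, r, ?_⟩
      simp only [switch_adj]
      grind [adj_comm, Adj.ne]
  have hp : ∀ x y, ¬ G.Adj v x → v ≠ x → ¬ G.Adj v y → v ≠ y → G.Adj x y → ¬ G.Adj p y →
      G.Adj x s ∧ G.Adj x t := by
    intro x y hvx nvx hvy nvy hxy hpy
    refine ⟨?_, ?_⟩ <;> by_contra hc
    · refine hL hvp hvx nvx hxy hpy (by grind) ⟨s, x, q, r, ?_⟩
      simp only [switch_adj]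
      grind [adj_comm, Adj.ne]
    · refine hL hvp hvx nvx hxy hpy (by grind) ⟨t, x, q, r, ?_⟩
      simp only [switch_adj]
      grind [adj_comm, Adj.ne]
  clear hL
  obtain ⟨x, hxS, hx⟩ := Finset.exists_mem_notMem_of_card_lt_card
    (s := {v, p, q, r, s, t}) (t := S) (Finset.card_le_six.trans_lt (by omega))
  simp only [Finset.mem_insert, Finset.mem_singleton, not_or] at hx
  have hvx : ¬ G.Adj v x := by grind
  have nvx : v ≠ x := by grind
  obtain ⟨y, hxy, hvy⟩ : ∃ y, G.Adj x y ∧ ¬ G.Adj v y := by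
    refine exists_adj_not_adj hv (hmin x hxS) ?_
    by_contra! hall
    exact (hst x hvx nvx (hall s hvs) (hall t hvt)).1 (hall p hvp)
  have nvy : v ≠ y := fun e => hvx (e ▸ hxy.symm)
  have s₁ := hs x y hvx nvx hvy nvy hxy
  have s₂ := hs y x hvy nvy hvx nvx hxy.symm
  have t₁ := ht x y hvx nvx hvy nvy hxy
  have t₂ := ht y x hvy nvy hvx nvx hxy.symm
  have p₁ := hp x y hvx nvx hvy nvy hxy
  have p₂ := hp y x hvy nvy hvx nvx hxy.symm
  have q₁ := hst x hvx nvx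
  have q₂ := hst y hvy nvy
  have hxn := hv x
  have hyn := hv y
  clear hs ht hp hst hv
  have c₁ := G.adj_comm x s
  have c₂ := G.adj_comm x t
  have c₃ := G.adj_comm x p
  have c₄ := G.adj_comm y s
  have c₅ := G.adj_comm y t
  have c₆ := G.adj_comm y p
  have nxs : x ≠ s ∧ x ≠ t ∧ x ≠ p := by grind
  have nys : y ≠ s ∧ y ≠ t ∧ y ≠ p := by grind
  by_cases hsy : G.Adj s y
  · by_cases hty : G.Adj t y
    · refine hB ⟨s, t, x, y, v, p, ?_⟩
      grind [adj_comm, Adj.ne]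
    · refine hB ⟨s, p, x, y, v, t, ?_⟩
      grind [adj_comm, Adj.ne]
  · refine hB ⟨t, p, x, y, v, s, ?_⟩
    grind [adj_comm, Adj.ne]

/-- If `v` cannot be lifted, any two pairs of non-adjacent neighbours of `v` intersect, so that these
pairs form a star or a triangle. -/
theorem reducible_of_nonadjacent_pair {G : SimpleGraph V} {S : Finset V}
    (hmin : ∀ x ∈ S, 5 ≤ G.deg x) (hcard : 8 ≤ S.card) {v a b c d e : V}
    (hv : ∀ z, G.Adj v z ↔ z = a ∨ z = b ∨ z = c ∨ z = d ∨ z = e)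
    (hne : a ≠ b ∧ a ≠ c ∧ a ≠ d ∧ a ≠ e ∧ b ≠ c ∧ b ≠ d ∧ b ≠ e ∧ c ≠ d ∧ c ≠ e ∧ d ≠ e)
    (hab : ¬ G.Adj a b) : Reducible G v := by
  by_contra hG
  have hL : ∀ x y z w, G.Adj v x → G.Adj v y → G.Adj v z → G.Adj v w →
      x ≠ y → z ≠ w → x ≠ z → x ≠ w → y ≠ z → y ≠ w → ¬ G.Adj x y → G.Adj z w := by
    intro x y z w hx hy hz hw _ _ _ _ _ _ hxy
    by_contra hzw
    exact hG (HasLift.reducible ⟨x, y, z, w, by tauto⟩)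
  have va := (hv a).2 (by simp)
  have vb := (hv b).2 (by simp)
  have vc := (hv c).2 (by simp)
  have vd := (hv d).2 (by simp)
  have ve := (hv e).2 (by simp)
  have cd : G.Adj c d := by apply hL a b <;> grind
  have ce : G.Adj c e := by apply hL a b <;> grind
  have de : G.Adj d e := by apply hL a b <;> grind
  have acbd : ¬ G.Adj a c → G.Adj b d := by apply hL a c <;> grind
  have acbe : ¬ G.Adj a c → G.Adj b e := by apply hL a c <;> grind
  have adbc : ¬ G.Adj a d → G.Adj b c := by apply hL a d <;> grind
  have adbe : ¬ G.Adj a d → G.Adj b e := by apply hL a d <;> grind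
  have aebc : ¬ G.Adj a e → G.Adj b c := by apply hL a e <;> grind
  have aebd : ¬ G.Adj a e → G.Adj b d := by apply hL a e <;> grind
  clear hL
  by_cases hb : G.Adj b c ∧ G.Adj b d ∧ G.Adj b e
  · exact hG (reducible_of_star hmin hcard hv (by grind) (by grind))
  by_cases ha : G.Adj a c ∧ G.Adj a d ∧ G.Adj a e
  · exact hG (reducible_of_star hmin hcard (c := b) (u₁ := a) (u₂ := c) (u₃ := d) (u₄ := e)
      (by grind) (by grind) (by grind))
  by_cases hac : G.Adj a c
  · by_cases had : G.Adj a d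
    · exact hG (reducible_of_triangle hmin hcard (p := a) (q := b) (r := e) (s := c) (t := d)
        (by grind) (by grind) (by grind) (by grind [adj_comm]))
    · exact hG (reducible_of_triangle hmin hcard (p := a) (q := b) (r := d) (s := c) (t := e)
        (by grind) (by grind) (by grind) (by grind [adj_comm]))
  · exact hG (reducible_of_triangle hmin hcard (p := a) (q := b) (r := c) (s := d) (t := e)
      (by grind) (by grind) (by grind) (by grind [adj_comm]))

/-- If the neighbours of a vertex of degree `5` form a clique, they form a `K₆` with it. -/
theorem reducible_of_deg_eq_five {G : SimpleGraph V} {S : Finset V} (hmin : ∀ x ∈ S, 5 ≤ G.deg x)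
    (hcard : 8 ≤ S.card) {v : V} (hv : G.deg v = 5) : Reducible G v := by
  obtain ⟨a, b, c, d, e, hv', hne⟩ := exists_nbs_five hv
  have key : ∀ a b c d e, (∀ z, G.Adj v z ↔ z = a ∨ z = b ∨ z = c ∨ z = d ∨ z = e) →
      (a ≠ b ∧ a ≠ c ∧ a ≠ d ∧ a ≠ e ∧ b ≠ c ∧ b ≠ d ∧ b ≠ e ∧ c ≠ d ∧ c ≠ e ∧ d ≠ e) →
      Reducible G v ∨ G.Adj a b := by
    intro a b c d e h h'
    by_cases hab : G.Adj a b
    · exact .inr hab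
    · exact .inl (reducible_of_nonadjacent_pair hmin hcard h h' hab)
  by_contra hG
  simp only [hG, false_or] at key
  have ab := key a b c d e (by grind) (by grind)
  have ac := key a c b d e (by grind) (by grind)
  have ad := key a d c b e (by grind) (by grind)
  have ae := key a e c d b (by grind) (by grind)
  have bc := key b c a d e (by grind) (by grind)
  have bd := key b d c a e (by grind) (by grind)
  have cd := key c d b a e (by grind) (by grind)
  have de := key d e a b c (by grind) (by grind)
  have va := (hv' a).2 (by simp)
  have vb := (hv' b).2 (by simp)
  have vc := (hv' c).2 (by simp)
  have vd := (hv' d).2 (by simp)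
  have ve := (hv' e).2 (by simp)
  exact hG (HasBook.reducible ⟨v, a, b, c, d, e, by grind [adj_comm]⟩ v)

end SimpleGraph

/-! ### Lifting and subdividing -/

namespace SimpleGraph
open Classical
section
variable {V : Type*}

/-- `G` without the edges at `v`. -/
def isolate (G : SimpleGraph V) (v : V) : SimpleGraph V where
  Adj i j := G.Adj i j ∧ i ≠ v ∧ j ≠ v
  symm := ⟨fun _ _ h => ⟨h.1.symm, h.2.2, h.2.1⟩⟩
  loopless := ⟨fun _ h => h.1.ne rfl⟩

/-- `G'` together with the edges of `G` at `v`. -/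
def attach (G' G : SimpleGraph V) (v : V) : SimpleGraph V where
  Adj i j := G'.Adj i j ∨ G.Adj i j ∧ (i = v ∨ j = v)
  symm := ⟨fun _ _ h => h.imp (fun e => e.symm) fun e => ⟨e.1.symm, e.2.symm⟩⟩
  loopless := ⟨fun _ h => h.elim (fun e => e.ne rfl) fun e => e.1.ne rfl⟩

/-- Replace the edges `vx`, `vy` by `xy`. -/
def lift (G : SimpleGraph V) (v x y : V) : SimpleGraph V :=
  ((G \ edge v x) \ edge v y) ⊔ edge x y

/-- Replace the edge `xy` by `vx`, `vy`. -/
def subdivide (G : SimpleGraph V) (v x y : V) : SimpleGraph V :=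
  ((G \ edge x y) ⊔ edge v x) ⊔ edge v y

theorem le_attach (G' G : SimpleGraph V) (v : V) : G' ≤ G'.attach G v := fun _ _ h => .inl h

theorem HasBook.mono {G G' : SimpleGraph V} (h : G ≤ G') (hG : HasBook G) : HasBook G' := by
  obtain ⟨a, b, p, q, r, s, h₁, h₂, h₃, h₄, h₅, h₆, h₇, h₈, h₉, h₁₀, h₁₁, hne⟩ := hG
  exact ⟨a, b, p, q, r, s, h h₁, h h₂, h h₃, h h₄, h h₅, h h₆, h h₇, h h₈, h h₉, h h₁₀, h h₁₁, hne⟩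

/-- Two disjoint edges `xy`, `zw`, not meeting `v` or its neighbours, can be removed without
destroying all copies of `K₆ - C₄`. -/
def HasFreePairs (G : SimpleGraph V) (v : V) : Prop :=
  ∃ x y z w, G.Adj x y ∧ G.Adj z w ∧ x ≠ z ∧ x ≠ w ∧ y ≠ z ∧ y ≠ w ∧
    (v ≠ x ∧ v ≠ y ∧ v ≠ z ∧ v ≠ w) ∧
    (¬ G.Adj v x ∧ ¬ G.Adj v y ∧ ¬ G.Adj v z ∧ ¬ G.Adj v w) ∧
    HasBook ((G \ edge x y) \ edge z w)

end

variable {V : Type*} [Fintype V]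

theorem not_adj_of_deg_eq_zero {G : SimpleGraph V} {v x : V} (h : G.deg v = 0) : ¬ G.Adj v x := by
  intro e
  exact Finset.card_ne_zero.2 ⟨x, mem_nbs.2 e⟩ h

theorem isolate_deg_self (G : SimpleGraph V) (v : V) : (G.isolate v).deg v = 0 := by
  rw [deg, Finset.card_eq_zero, Finset.eq_empty_iff_forall_notMem]
  intro x hx
  exact (mem_nbs.1 hx).2.1 rfl

theorem isolate_deg (G : SimpleGraph V) {v z : V} (hz : z ≠ v) :
    (G.isolate v).deg z + (if G.Adj v z then 1 else 0) = G.deg z := by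
  have h : (G.isolate v).nbs z = (G.nbs z).erase v := by
    ext x
    simp only [mem_nbs, Finset.mem_erase, isolate]
    tauto
  rw [deg, h]
  split_ifs with hvz
  · exact Finset.card_erase_add_one (mem_nbs.2 hvz.symm)
  · rw [Finset.erase_eq_of_notMem (fun e => hvz (mem_nbs.1 e).symm)]
    rfl

theorem attach_deg_self (G' G : SimpleGraph V) {v : V} (h : G'.deg v = 0) :
    (G'.attach G v).deg v = G.deg v := by
  unfold deg
  congr 1
  ext x
  simp [attach, not_adj_of_deg_eq_zero h]

theorem attach_deg (G' G : SimpleGraph V) {v z : V} (h : G'.deg v = 0) (hz : z ≠ v) :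
    (G'.attach G v).deg z = G'.deg z + (if G.Adj v z then 1 else 0) := by
  have h' : (G'.attach G v).nbs z = if G.Adj v z then insert v (G'.nbs z) else G'.nbs z := by
    ext x
    split_ifs with hvz
    · simp only [mem_nbs, Finset.mem_insert, attach]
      constructor
      · rintro (e | ⟨e, rfl | rfl⟩) <;> tauto
      · rintro (rfl | e)
        · exact .inr ⟨hvz.symm, .inr rfl⟩
        · exact .inl e
    · simp only [mem_nbs, attach]
      constructor
      · rintro (e | ⟨e, rfl | rfl⟩)
        · exact e
        · exact absurd rfl hz
        · exact absurd e.symm hvz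
      · exact .inl
  rw [deg, h']
  split_ifs with hvz
  · rw [Finset.card_insert_of_notMem]
    · rfl
    · exact fun e => not_adj_of_deg_eq_zero h (mem_nbs.1 e).symm
  · rfl

theorem attach_sameDeg {G G' : SimpleGraph V} {v : V} (h : SameDeg (G.isolate v) G') :
    SameDeg G (G'.attach G v) := by
  have hv : G'.deg v = 0 := (h v).trans (isolate_deg_self G v)
  intro z
  by_cases hz : z = v
  · subst hz
    exact attach_deg_self G' G hv
  · rw [attach_deg G' G hv hz, h z, isolate_deg G hz]

theorem sum_isolate_deg (G : SimpleGraph V) (v : V) :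
    ∑ z, (G.isolate v).deg z + 2 * G.deg v = ∑ z, G.deg z := by
  have h1 : ∑ z, (if G.Adj v z then 1 else 0) = G.deg v := by
    rw [deg, nbs, Finset.card_filter]
  have h2 : ∑ z, ((G.isolate v).deg z + (if G.Adj v z then 1 else 0) +
      (if z = v then G.deg v else 0)) = ∑ z, G.deg z := by
    refine Finset.sum_congr rfl fun z _ => ?_
    split_ifs with h₁ h₂ h₂
    · exact absurd h₂ h₁.ne'
    · rw [← isolate_deg G h₁.ne', if_pos h₁]
    · subst h₂
      simp [isolate_deg_self]
    · rw [← isolate_deg G h₂, if_neg h₁]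
  rw [← h2, Finset.sum_add_distrib, Finset.sum_add_distrib, h1]
  simp
  omega

theorem lift_deg (G : SimpleGraph V) {v x y : V} (hx : G.Adj v x) (hy : G.Adj v y)
    (hxy : ¬ G.Adj x y) (ne : x ≠ y) (z : V) :
    (G.lift v x y).deg z + (if z = v then 2 else 0) = G.deg z := by
  have nvx := hx.ne
  have nvy := hy.ne
  have h1 := deg_del G hx z
  have h2 := deg_del (G \ edge v x) (x := v) (y := y)
    (by simp only [sdiff_adj, edge_adj]; grind) z
  have h3 := deg_add ((G \ edge v x) \ edge v y) ne (by simp only [sdiff_adj, edge_adj]; grind) z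
  unfold lift
  grind

theorem subdivide_deg (G : SimpleGraph V) {v x y : V} (hxy : G.Adj x y) (hx : ¬ G.Adj v x)
    (hy : ¬ G.Adj v y) (nvx : v ≠ x) (nvy : v ≠ y) (z : V) :
    (G.subdivide v x y).deg z = G.deg z + (if z = v then 2 else 0) := by
  have ne := hxy.ne
  have h1 := deg_del G hxy z
  have h2 := deg_add (G \ edge x y) nvx (by simp only [sdiff_adj, edge_adj]; grind) z
  have h3 := deg_add ((G \ edge x y) ⊔ edge v x) nvy
    (by simp only [sup_adj, sdiff_adj, edge_adj]; grind) z
  unfold subdivide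
  grind

/-- Some graph with the degrees of `G` contains `K₆ - C₄`. -/
def PotentiallyBook (G : SimpleGraph V) : Prop := ∃ G', SameDeg G G' ∧ HasBook G'

theorem PotentiallyBook.of_sameDeg {G G' : SimpleGraph V} (h : SameDeg G G')
    (h' : PotentiallyBook G') : PotentiallyBook G := by
  obtain ⟨G'', h1, h2⟩ := h'
  exact ⟨G'', h.trans h1, h2⟩

theorem HasFreePairs.potentiallyBook {G G₀ : SimpleGraph V} {v : V} (h : HasFreePairs G v)
    (hv : G₀.deg v = G.deg v + 4) (hne : ∀ z ≠ v, G₀.deg z = G.deg z) : PotentiallyBook G₀ := by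
  obtain ⟨x, y, z, w, hxy, hzw, nxz, nxw, nyz, nyw, ⟨nvx, nvy, nvz, nvw⟩, ⟨hvx, hvy, hvz, hvw⟩,
    hB⟩ := h
  refine ⟨(G.subdivide v x y).subdivide v z w, fun i => ?_, hB.mono fun i j hij => ?_⟩
  · have h1 := subdivide_deg G hxy hvx hvy nvx nvy i
    have h2 := subdivide_deg (G.subdivide v x y) (v := v) (x := z) (y := w)
      (by simp only [subdivide, sup_adj, sdiff_adj, edge_adj]; grind)
      (by simp only [subdivide, sup_adj, sdiff_adj, edge_adj]; grind)
      (by simp only [subdivide, sup_adj, sdiff_adj, edge_adj]; grind) nvz nvw i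
    by_cases hi : i = v
    · subst hi
      simp only [if_true] at h1 h2
      omega
    · have := hne i hi
      simp only [hi, if_false] at h1 h2
      omega
  · simp only [sdiff_adj] at hij
    simp only [subdivide, sup_adj, sdiff_adj]
    tauto

theorem potentiallyBook_of_isolate {G : SimpleGraph V} {v : V}
    (h : PotentiallyBook (G.isolate v)) : PotentiallyBook G := by
  obtain ⟨G', hG', hB⟩ := h
  exact ⟨G'.attach G v, attach_sameDeg hG', hB.mono (le_attach G' G v)⟩

/-- Lift two pairs of edges at `v`, delete `v`, find a copy of `K₆ - C₄` in a graph with the degrees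
of the rest, and put `v` back by subdividing two edges outside the copy. -/
theorem potentiallyBook_of_hasLift {G : SimpleGraph V} {v : V} (hL : HasLift G v)
    (ih : ∀ G' : SimpleGraph V, G'.deg v = 0 → (∀ z, G'.deg z ≤ G.deg z) →
      ∑ z, G'.deg z + 2 * G.deg v = ∑ z, G.deg z + 4 → PotentiallyBook G')
    (hF : ∀ G' : SimpleGraph V, (∀ z ≠ v, G'.deg z = G.deg z) → G.deg v = G'.deg v + 4 →
      HasBook G' → HasFreePairs G' v) : PotentiallyBook G := by
  obtain ⟨x, y, z, w, hx, hy, hz, hw, hxy, hzw, nxy, nzw, nxz, nxw, nyz, nyw⟩ := hL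
  have h1 := lift_deg G hx hy hxy nxy
  have h2 := lift_deg (G.lift v x y) (v := v) (x := z) (y := w)
    (by simp only [lift, sup_adj, sdiff_adj, edge_adj]; grind [Adj.ne])
    (by simp only [lift, sup_adj, sdiff_adj, edge_adj]; grind [Adj.ne])
    (by simp only [lift, sup_adj, sdiff_adj, edge_adj]; grind [Adj.ne]) nzw
  set G₁ := (G.lift v x y).lift v z w with hG₁
  have h3 : ∀ i, G₁.deg i + (if i = v then 4 else 0) = G.deg i := by
    intro i
    have := h1 i
    have := h2 i
    split_ifs at * <;> omega
  have hv := h3 v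
  have hi : ∀ i ≠ v, G₁.deg i = G.deg i := by
    intro i hi
    have := h3 i
    simpa [hi] using this
  have hsum : ∑ i, G₁.deg i + 4 = ∑ i, G.deg i := by
    simp_rw [← h3, Finset.sum_add_distrib]
    simp
  have hsum' := sum_isolate_deg G₁ v
  rw [if_pos rfl] at hv
  obtain ⟨G₂, hG₂, hB⟩ := ih (G₁.isolate v) (isolate_deg_self G₁ v) (fun i => by
    by_cases hiv : i = v
    · rw [hiv, isolate_deg_self]
      exact Nat.zero_le _
    · have := isolate_deg G₁ hiv
      have := hi i hiv
      omega) (by omega)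
  have hsd := attach_sameDeg hG₂
  refine (hF (G₂.attach G₁ v) ?_ ?_ (hB.mono (le_attach _ _ _))).potentiallyBook ?_ ?_
  · intro i hiv
    rw [hsd i, hi i hiv]
  · rw [hsd v, hv]
  · rw [hsd v, hv]
  · intro i hiv
    rw [hsd i, hi i hiv]

end SimpleGraph

/-! ### Edges outside a copy of `K₆ - C₄` -/

namespace SimpleGraph
open Classical
section
variable {V : Type*}

/-- The cliques `abpq` and `abrs` form a copy of `K₆ - C₄` in `G`. -/
def IsBook (G : SimpleGraph V) (a b p q r s : V) : Prop :=
  G.Adj a b ∧ G.Adj a p ∧ G.Adj a q ∧ G.Adj a r ∧ G.Adj a s ∧ G.Adj b p ∧ G.Adj b q ∧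
    G.Adj b r ∧ G.Adj b s ∧ G.Adj p q ∧ G.Adj r s ∧ p ≠ r ∧ p ≠ s ∧ q ≠ r ∧ q ≠ s

namespace IsBook
variable {G : SimpleGraph V} {v a b p q r s : V}

theorem hasBook (h : IsBook G a b p q r s) : HasBook G := ⟨a, b, p, q, r, s, h⟩

theorem swap_left (h : IsBook G a b p q r s) : IsBook G a b q p r s := by
  unfold IsBook at *
  simp only [G.adj_comm q p]
  tauto

theorem swap (h : IsBook G a b p q r s) : IsBook G a b r s p q := by
  unfold IsBook at *
  simp only [ne_comm (a := r), ne_comm (a := s)]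
  tauto

theorem swap_right (h : IsBook G a b p q r s) : IsBook G a b p q s r := h.swap.swap_left.swap

theorem sdiff_cross (h : IsBook G a b p q r s) : IsBook (G \ edge p r) a b p q r s := by
  obtain ⟨h₁, h₂, h₃, h₄, h₅, h₆, h₇, h₈, h₉, h₁₀, h₁₁, hpr, hps, hqr, hqs⟩ := h
  simp [IsBook, edge_adj, *, h₁.ne, h₂.ne, h₃.ne, h₄.ne, h₅.ne, h₆.ne, h₇.ne, h₈.ne, h₉.ne,
    h₁₀.ne, h₁₁.ne, h₁₀.ne', h₁₁.ne', hpr.symm, hps.symm]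

theorem sdiff_outer (h : IsBook G a b p q r s) {w z : V}
    (hw : w ≠ a ∧ w ≠ b ∧ w ≠ p ∧ w ≠ q ∧ w ≠ r ∧ w ≠ s) :
    IsBook (G \ edge w z) a b p q r s := by
  obtain ⟨h₁, h₂, h₃, h₄, h₅, h₆, h₇, h₈, h₉, h₁₀, h₁₁, hpr, hps, hqr, hqs⟩ := h
  obtain ⟨wa, wb, wp, wq, wr, ws⟩ := hw
  simp [IsBook, edge_adj, *, wa.symm, wb.symm, wp.symm, wq.symm, wr.symm, ws.symm]

theorem hasFreePairs_of_cross (h : IsBook G a b p q r s) (hv : ∀ x, ¬ G.Adj v x)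
    (hpr : G.Adj p r) (hqs : G.Adj q s) : HasFreePairs G v := by
  have hnv : ∀ {x y}, G.Adj x y → v ≠ x := fun {x y} e h => hv y (h ▸ e)
  have hB := h.sdiff_cross.swap_left.swap_right.sdiff_cross.hasBook
  obtain ⟨-, -, -, -, -, -, -, -, -, hpq, hrs, -, nps, nqr, -⟩ := h
  exact ⟨p, r, q, s, hpr, hqs, hpq.ne, nps, nqr.symm, hrs.ne,
    ⟨hnv hpr, hnv hpr.symm, hnv hqs, hnv hqs.symm⟩, ⟨hv _, hv _, hv _, hv _⟩, hB⟩

end IsBook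

theorem card_book {G : SimpleGraph V} {v a b p q r s : V} (hv : ∀ x, ¬ G.Adj v x)
    (h : IsBook G a b p q r s) :
    ({v, a, b, p, q, r, s} : Finset V).card = 7 := by
  have hmem : ∀ {x y}, G.Adj x y → v ≠ x := fun {x y} e h => hv y (h ▸ e)
  obtain ⟨h₁, h₂, h₃, h₄, h₅, h₆, h₇, h₈, h₉, h₁₀, h₁₁, hpr, hps, hqr, hqs⟩ := h
  simp [Finset.card_insert_of_notMem, h₁.ne, h₂.ne, h₃.ne, h₄.ne, h₅.ne, h₆.ne, h₇.ne, h₈.ne,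
    h₉.ne, h₁₀.ne, h₁₁.ne, hpr, hps, hqr, hqs, hmem h₁, hmem h₁.symm, hmem h₁₀, hmem h₁₀.symm,
    hmem h₁₁, hmem h₁₁.symm]

end

variable {V : Type*} [Fintype V]

/-- Two vertices `x`, `y` outside a copy of `K₆ - C₄`, not adjacent to `v`, provide free pairs. -/
theorem hasFreePairs_of_card {G : SimpleGraph V} {S : Finset V} {v : V}
    (hmin : ∀ z ∈ S, z ≠ v → 4 + G.deg v ≤ G.deg z) (hcard : 9 + G.deg v ≤ S.card)
    (hB : HasBook G) : HasFreePairs G v := by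
  obtain ⟨a, b, p, q, r, s, hB⟩ := hB
  have hout : ∀ n, n ≤ 1 → ∀ T : Finset V, T.card ≤ n → ∃ x ∈ S, x ≠ v ∧ ¬ G.Adj v x ∧
      (x ≠ a ∧ x ≠ b ∧ x ≠ p ∧ x ≠ q ∧ x ≠ r ∧ x ≠ s) ∧ x ∉ T := by
    intro n hn T hT
    have h1 := Finset.card_union_le ({a, b, p, q, r, s} ∪ T) (insert v (G.nbs v))
    have h2 := Finset.card_union_le {a, b, p, q, r, s} T
    have h3 : ({a, b, p, q, r, s} : Finset V).card ≤ 6 := Finset.card_le_six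
    have h4 := Finset.card_insert_le v (G.nbs v)
    have h5 : (G.nbs v).card = G.deg v := rfl
    obtain ⟨x, hx, hx'⟩ := Finset.exists_mem_notMem_of_card_lt_card
      (s := ({a, b, p, q, r, s} ∪ T) ∪ insert v (G.nbs v)) (t := S) (by omega)
    simp only [Finset.mem_union, Finset.mem_insert, Finset.mem_singleton, mem_nbs, not_or] at hx'
    exact ⟨x, hx, hx'.2.1, hx'.2.2, hx'.1.1, hx'.1.2⟩
  obtain ⟨x, hxS, nxv, hvx, hx, -⟩ := hout 0 (by simp) ∅ (by simp)
  obtain ⟨y, hyS, nyv, hvy, hy, nyx⟩ := hout 1 le_rfl {x} (by simp)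
  rw [Finset.mem_singleton] at nyx
  have hcardT : ∀ i j : V, (insert i (insert j (G.nbs v))).card < 4 + G.deg v := by
    intro i j
    have h1 := Finset.card_insert_le i (insert j (G.nbs v))
    have h2 := Finset.card_insert_le j (G.nbs v)
    have h5 : (G.nbs v).card = G.deg v := rfl
    omega
  obtain ⟨z, hxz, hz⟩ := exists_adj_notMem (hmin x hxS nxv) (hcardT y y)
  obtain ⟨w, hyw, hw⟩ := exists_adj_notMem (hmin y hyS nyv) (hcardT x z)
  simp only [Finset.mem_insert, mem_nbs, not_or] at hz hw
  have nvz : v ≠ z := fun e => hvx (e ▸ hxz.symm)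
  have nvw : v ≠ w := fun e => hvy (e ▸ hyw.symm)
  refine ⟨x, z, y, w, hxz, hyw, Ne.symm nyx, Ne.symm hw.1, hz.1, Ne.symm hw.2.1,
    ⟨nxv.symm, nvz, nyv.symm, nvw⟩, ⟨hvx, hz.2.2, hvy, hw.2.2⟩, a, b, p, q, r, s, ?_⟩
  have key : ∀ i j, x ≠ i → x ≠ j → y ≠ i → y ≠ j → G.Adj i j →
      ((G \ edge x z) \ edge y w).Adj i j := by
    intro i j _ _ _ _ hij
    simp only [sdiff_adj, edge_adj]
    grind
  obtain ⟨h₁, h₂, h₃, h₄, h₅, h₆, h₇, h₈, h₉, h₁₀, h₁₁, hne⟩ := hB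
  obtain ⟨xa, xb, xp, xq, xr, xs⟩ := hx
  obtain ⟨ya, yb, yp, yq, yr, ys⟩ := hy
  refine ⟨?_, ?_, ?_, ?_, ?_, ?_, ?_, ?_, ?_, ?_, ?_, hne⟩ <;> apply key <;> assumption

namespace IsBook
variable {G : SimpleGraph V} {v a b p q r s : V}

theorem hasFreePairs_of_adj (h : IsBook G a b p q r s) (hv : ∀ x, ¬ G.Adj v x)
    (hpr : G.Adj p r) {w : V} (hw : w ≠ a ∧ w ≠ b ∧ w ≠ p ∧ w ≠ q ∧ w ≠ r ∧ w ≠ s)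
    (hdeg : 4 ≤ G.deg w) : HasFreePairs G v := by
  have hnv : ∀ {x y}, G.Adj x y → v ≠ x := fun {x y} e h => hv y (h ▸ e)
  obtain ⟨z, hwz, hz⟩ := exists_adj_notMem hdeg (T := {p, r})
    (Finset.card_le_two.trans_lt (by simp))
  simp only [Finset.mem_insert, Finset.mem_singleton, not_or] at hz
  exact ⟨p, r, w, z, hpr, hwz, hw.2.2.1.symm, Ne.symm hz.1, hw.2.2.2.2.1.symm, Ne.symm hz.2,
    ⟨hnv hpr, hnv hpr.symm, hnv hwz, hnv hwz.symm⟩, ⟨hv _, hv _, hv _, hv _⟩,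
    (h.sdiff_cross.sdiff_outer hw).hasBook⟩

end IsBook

theorem book_subset {G : SimpleGraph V} {S : Finset V} (hS : ∀ x ∉ S, G.deg x = 0)
    {v a b p q r s : V} (hvS : v ∈ S) (hab : G.Adj a b) (hpq : G.Adj p q) (hrs : G.Adj r s) :
    ({v, a, b, p, q, r, s} : Finset V) ⊆ S := by
  intro x hx
  simp only [Finset.mem_insert, Finset.mem_singleton] at hx
  rcases hx with rfl | rfl | rfl | rfl | rfl | rfl | rfl
  exacts [hvS, mem_of_deg_ne_zero hS hab, mem_of_deg_ne_zero hS hab.symm,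
    mem_of_deg_ne_zero hS hpq, mem_of_deg_ne_zero hS hpq.symm, mem_of_deg_ne_zero hS hrs,
    mem_of_deg_ne_zero hS hrs.symm]

/-- If a copy of `K₆ - C₄` covers all vertices but `v`, then one of the two perfect matchings between
`pq` and `rs` is present, and its edges are free. -/
theorem hasFreePairs_of_card_eq_seven {G : SimpleGraph V} {S : Finset V}
    (hS : ∀ x ∉ S, G.deg x = 0) {v : V} (hvS : v ∈ S) (hv : G.deg v = 0)
    (hmin : ∀ z ∈ S, z ≠ v → 4 ≤ G.deg z) (hcard : S.card = 7) (hB : HasBook G) :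
    HasFreePairs G v := by
  obtain ⟨a, b, p, q, r, s, hB⟩ := hB
  have hbook : IsBook G a b p q r s := hB
  have hvx : ∀ x, ¬ G.Adj v x := fun x => not_adj_of_deg_eq_zero hv
  have hc := card_book hvx hB
  obtain ⟨h₁, h₂, h₃, h₄, h₅, h₆, h₇, h₈, h₉, h₁₀, h₁₁, hpr, hps, hqr, hqs⟩ := hB
  have hSeq := Finset.eq_of_subset_of_card_le (book_subset hS hvS h₁ h₁₀ h₁₁) (by omega)
  have hnv : ∀ {x y}, G.Adj x y → v ≠ x := fun {x y} e h => hvx y (h ▸ e)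
  have hall : ∀ {x y}, G.Adj x y → x = a ∨ x = b ∨ x = p ∨ x = q ∨ x = r ∨ x = s := by
    intro x y e
    have h1 := mem_of_deg_ne_zero hS e
    have h2 := hnv e
    rw [← hSeq] at h1
    simp only [Finset.mem_insert, Finset.mem_singleton] at h1
    exact h1.resolve_left h2.symm
  have hnb : ∀ {x y} c, G.Adj x y → ∃ z, G.Adj x z ∧ z ≠ a ∧ z ≠ b ∧ z ≠ c := by
    intro x y c e
    obtain ⟨z, hz, hz'⟩ := exists_adj_notMem (hmin x (mem_of_deg_ne_zero hS e) (hnv e).symm)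
      (T := {a, b, c}) (Finset.card_le_three.trans_lt (by simp))
    simp only [Finset.mem_insert, Finset.mem_singleton, not_or] at hz'
    exact ⟨z, hz, hz'⟩
  -- Each of `p`, `q`, `r`, `s` has a fourth neighbour, in the other pair.
  obtain ⟨p', hp, hp'⟩ := hnb q h₁₀
  obtain ⟨q', hq, hq'⟩ := hnb p h₁₀.symm
  obtain ⟨r', hr, hr'⟩ := hnb s h₁₁
  obtain ⟨s', hs, hs'⟩ := hnb r h₁₁.symm
  clear hnb
  have ep : G.Adj p r ∨ G.Adj p s := by
    rcases hall hp.symm with e | e | e | e | e | e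
    exacts [absurd e hp'.1, absurd e hp'.2.1, absurd e hp.ne', absurd e hp'.2.2, .inl (e ▸ hp),
      .inr (e ▸ hp)]
  have eq : G.Adj q r ∨ G.Adj q s := by
    rcases hall hq.symm with e | e | e | e | e | e
    exacts [absurd e hq'.1, absurd e hq'.2.1, absurd e hq'.2.2, absurd e hq.ne', .inl (e ▸ hq),
      .inr (e ▸ hq)]
  have er : G.Adj p r ∨ G.Adj q r := by
    rcases hall hr.symm with e | e | e | e | e | e
    exacts [absurd e hr'.1, absurd e hr'.2.1, .inl (e ▸ hr.symm), .inr (e ▸ hr.symm),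
      absurd e hr.ne', absurd e hr'.2.2]
  have es : G.Adj p s ∨ G.Adj q s := by
    rcases hall hs.symm with e | e | e | e | e | e
    exacts [absurd e hs'.1, absurd e hs'.2.1, .inl (e ▸ hs.symm), .inr (e ▸ hs.symm),
      absurd e hs'.2.2, absurd e hs.ne']
  by_cases h : G.Adj p r ∧ G.Adj q s
  · exact hbook.hasFreePairs_of_cross hvx h.1 h.2
  · have h' : G.Adj p s ∧ G.Adj q r := by
      clear hbook hall hp hq hr hs hS hmin hc hnv
      grind
    exact hbook.swap_right.hasFreePairs_of_cross hvx h'.1 h'.2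

set_option maxHeartbeats 400000 in
/-- Free pairs if exactly one vertex `w ≠ v` lies outside the copy of `K₆ - C₄`. When no edge joins
`pq` to `rs`, counting edges shows that `a`, `b`, `w` are adjacent to all other vertices; the copy
formed by `abrs` and `abwq` then leaves `ap` and `wr` free. -/
theorem hasFreePairs_of_card_eq_eight {G : SimpleGraph V} {S : Finset V}
    (hS : ∀ x ∉ S, G.deg x = 0) {v : V} (hvS : v ∈ S) (hv : G.deg v = 0)
    (hmin : ∀ z ∈ S, z ≠ v → 4 ≤ G.deg z) (hcard : S.card = 8)
    (hsum : 34 ≤ ∑ z, G.deg z) (hB : HasBook G) :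
    HasFreePairs G v := by
  obtain ⟨a, b, p, q, r, s, hB⟩ := hB
  have hbook : IsBook G a b p q r s := hB
  have hvx : ∀ x, ¬ G.Adj v x := fun x => not_adj_of_deg_eq_zero hv
  have hc := card_book hvx hB
  obtain ⟨h₁, h₂, h₃, h₄, h₅, h₆, h₇, h₈, h₉, h₁₀, h₁₁, hpr, hps, hqr, hqs⟩ := hB
  have hsub := book_subset hS hvS h₁ h₁₀ h₁₁
  obtain ⟨w, hwS, hw⟩ := Finset.exists_mem_notMem_of_card_lt_card
    (s := {v, a, b, p, q, r, s}) (t := S) (by omega)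
  have hSeq := Finset.eq_of_subset_of_card_le (Finset.insert_subset hwS hsub)
    (by rw [Finset.card_insert_of_notMem hw]; omega)
  have hnv : ∀ {x y}, G.Adj x y → v ≠ x := fun {x y} e h => hvx y (h ▸ e)
  have hall : ∀ {x y}, G.Adj x y → x = w ∨ x = a ∨ x = b ∨ x = p ∨ x = q ∨ x = r ∨ x = s := by
    intro x y e
    have h1 := mem_of_deg_ne_zero hS e
    have h2 := hnv e
    rw [← hSeq] at h1
    simp only [Finset.mem_insert, Finset.mem_singleton] at h1
    exact h1.imp id fun h => h.resolve_left h2.symm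
  have hw' := hw
  simp only [Finset.mem_insert, Finset.mem_singleton, not_or] at hw'
  obtain ⟨wv, wa, wb, wp, wq, wr, ws⟩ := hw'
  have hwdeg := hmin w hwS wv
  have hw₁ := And.intro wa (And.intro wb (And.intro wp (And.intro wq (And.intro wr ws))))
  by_cases e₁ : G.Adj p r
  · exact hbook.hasFreePairs_of_adj hvx e₁ hw₁ hwdeg
  by_cases e₂ : G.Adj p s
  · exact hbook.swap_right.hasFreePairs_of_adj hvx e₂ ⟨wa, wb, wp, wq, ws, wr⟩ hwdeg
  by_cases e₃ : G.Adj q r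
  · exact hbook.swap_left.hasFreePairs_of_adj hvx e₃ ⟨wa, wb, wq, wp, wr, ws⟩ hwdeg
  by_cases e₄ : G.Adj q s
  · exact hbook.swap_left.swap_right.hasFreePairs_of_adj hvx e₄
      ⟨wa, wb, wq, wp, ws, wr⟩ hwdeg
  have hle4 : ∀ x c, (∀ y, G.Adj x y → y = a ∨ y = b ∨ y = c ∨ y = w) → G.deg x ≤ 4 := by
    intro x c h
    refine (Finset.card_le_card (t := {a, b, c, w}) fun y hy => ?_).trans Finset.card_le_four
    simpa using h y (mem_nbs.1 hy)
  have dp := hle4 p q fun y hy => by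
    rcases hall hy.symm with e | e | e | e | e | e | e <;> subst e <;>
      first | simp | exact absurd rfl hy.ne | exact absurd hy ‹_›
  have dq := hle4 q p fun y hy => by
    rcases hall hy.symm with e | e | e | e | e | e | e <;> subst e <;>
      first | simp | exact absurd rfl hy.ne | exact absurd hy ‹_›
  have dr := hle4 r s fun y hy => by
    rcases hall hy.symm with e | e | e | e | e | e | e <;> subst e <;>
      first | simp | exact absurd rfl hy.ne | exact absurd hy.symm ‹_›
  have ds := hle4 s r fun y hy => by
    rcases hall hy.symm with e | e | e | e | e | e | e <;> subst e <;>
      first | simp | exact absurd rfl hy.ne | exact absurd hy.symm ‹_›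
  have hle6 : ∀ x c d e f g h, (∀ y, G.Adj x y → y = c ∨ y = d ∨ y = e ∨ y = f ∨ y = g ∨ y = h) →
      G.deg x ≤ 6 := by
    intro x c d e f g h hy
    refine (Finset.card_le_card (t := {c, d, e, f, g, h}) fun y hy' => ?_).trans
      Finset.card_le_six
    simpa using hy y (mem_nbs.1 hy')
  have da := hle6 a w b p q r s fun y hy => by
    rcases hall hy.symm with e | e | e | e | e | e | e <;> subst e <;>
      first | simp | exact absurd rfl hy.ne
  have db := hle6 b w a p q r s fun y hy => by
    rcases hall hy.symm with e | e | e | e | e | e | e <;> subst e <;>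
      first | simp | exact absurd rfl hy.ne
  -- The degrees of `v`, of `p`, `q`, `r`, `s` and of `a`, `b` sum to at most `0 + 16 + 12`.
  have hwdeg : 6 ≤ G.deg w := by
    have hS' : ∑ z ∈ S, G.deg z = ∑ z, G.deg z :=
      Finset.sum_subset (Finset.subset_univ S) fun x _ hx => hS x hx
    rw [← hS', ← hSeq, Finset.sum_insert hw] at hsum
    have hne : v ≠ a ∧ v ≠ b ∧ v ≠ p ∧ v ≠ q ∧ v ≠ r ∧ v ≠ s :=
      ⟨hnv h₁, hnv h₁.symm, hnv h₁₀, hnv h₁₀.symm, hnv h₁₁, hnv h₁₁.symm⟩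
    rw [Finset.sum_insert (by simp [hne]),
      Finset.sum_insert (by simp [h₁.ne, h₂.ne, h₃.ne, h₄.ne, h₅.ne]),
      Finset.sum_insert (by simp [h₆.ne, h₇.ne, h₈.ne, h₉.ne]),
      Finset.sum_insert (by simp [h₁₀.ne, hpr, hps]),
      Finset.sum_insert (by simp [hqr, hqs]), Finset.sum_pair h₁₁.ne] at hsum
    omega
  have hN : G.nbs w = {a, b, p, q, r, s} := by
    refine Finset.eq_of_subset_of_card_le (fun y hy => ?_) (Finset.card_le_six.trans hwdeg)
    have hy' := mem_nbs.1 hy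
    simpa using (hall hy'.symm).resolve_left hy'.ne'
  have wa' : G.Adj w a := mem_nbs.1 (by simp [hN])
  have wb' : G.Adj w b := mem_nbs.1 (by simp [hN])
  have wq' : G.Adj w q := mem_nbs.1 (by simp [hN])
  have wr' : G.Adj w r := mem_nbs.1 (by simp [hN])
  have hbook' : IsBook G a b w q r s := ⟨h₁, wa'.symm, h₃, h₄, h₅, wb'.symm, h₇, h₈, h₉, wq', h₁₁,
    wr, ws, hqr, hqs⟩
  refine ⟨p, a, w, r, h₂.symm, wr', Ne.symm wp, hpr, Ne.symm wa, h₄.ne,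
    ⟨hnv h₂.symm, hnv h₂, hnv wr', hnv wr'.symm⟩, by simp [hvx],
    (hbook'.sdiff_outer ⟨h₂.ne', h₆.ne', Ne.symm wp, h₁₀.ne, hpr, hps⟩).sdiff_cross.hasBook⟩

end SimpleGraph

/-! ### Two triangles with a common vertex -/

namespace SimpleGraph
open Classical
section
variable {V : Type*}

/-- The triangles `cpq` and `crs` share exactly the vertex `c`. -/
def IsButterfly (G : SimpleGraph V) (c p q r s : V) : Prop :=
  G.Adj c p ∧ G.Adj c q ∧ G.Adj c r ∧ G.Adj c s ∧ G.Adj p q ∧ G.Adj r s ∧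
    p ≠ r ∧ p ≠ s ∧ q ≠ r ∧ q ≠ s

/-- `G` contains two triangles with exactly one vertex in common, that is, a copy of
`K₁ ∨ 2K₂`. -/
def HasButterfly (G : SimpleGraph V) : Prop := ∃ c p q r s, IsButterfly G c p q r s

theorem HasButterfly.mono {G G' : SimpleGraph V} (h : G ≤ G') (hG : HasButterfly G) :
    HasButterfly G' := by
  obtain ⟨c, p, q, r, s, h₁, h₂, h₃, h₄, h₅, h₆, hne⟩ := hG
  exact ⟨c, p, q, r, s, h h₁, h h₂, h h₃, h h₄, h h₅, h h₆, hne⟩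

namespace IsButterfly
variable {G : SimpleGraph V} {v c p q r s : V}

theorem swap_left (h : IsButterfly G c p q r s) : IsButterfly G c q p r s := by
  unfold IsButterfly at *
  simp only [G.adj_comm q p]
  tauto

theorem swap (h : IsButterfly G c p q r s) : IsButterfly G c r s p q := by
  unfold IsButterfly at *
  simp only [ne_comm (a := r), ne_comm (a := s)]
  tauto

theorem swap_right (h : IsButterfly G c p q r s) : IsButterfly G c p q s r :=
  h.swap.swap_left.swap

theorem sdiff_cross (h : IsButterfly G c p q r s) : IsButterfly (G \ edge p r) c p q r s := by
  obtain ⟨h₁, h₂, h₃, h₄, h₅, h₆, hpr, hps, hqr, hqs⟩ := h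
  simp [IsButterfly, edge_adj, *, h₁.ne, h₂.ne, h₃.ne, h₄.ne, h₅.ne, h₆.ne, h₅.ne', h₆.ne',
    hpr.symm, hps.symm]

theorem sdiff_outer (h : IsButterfly G c p q r s) {w z : V}
    (hw : w ≠ c ∧ w ≠ p ∧ w ≠ q ∧ w ≠ r ∧ w ≠ s) : IsButterfly (G \ edge w z) c p q r s := by
  obtain ⟨h₁, h₂, h₃, h₄, h₅, h₆, hpr, hps, hqr, hqs⟩ := h
  obtain ⟨wc, wp, wq, wr, ws⟩ := hw
  simp [IsButterfly, edge_adj, *, wc.symm, wp.symm, wq.symm, wr.symm, ws.symm]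

end IsButterfly

/-- An edge `xy`, not meeting `v` or its neighbours, can be removed without destroying all copies of
`K₁ ∨ 2K₂`. -/
def HasFreeEdge (G : SimpleGraph V) (v : V) : Prop :=
  ∃ x y, G.Adj x y ∧ v ≠ x ∧ v ≠ y ∧ ¬ G.Adj v x ∧ ¬ G.Adj v y ∧ HasButterfly (G \ edge x y)

/-- The number of vertices in `S` other than `x` that are not adjacent to `x`. -/
noncomputable def coDeg (G : SimpleGraph V) (S : Finset V) (x : V) : ℕ :=
  ∑ y ∈ S, if x ≠ y ∧ ¬ G.Adj x y then 1 else 0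

theorem exists_coDeg_eq_zero {G : SimpleGraph V} {S : Finset V} (hcard : 5 ≤ S.card)
    (h : ∑ x ∈ S, G.coDeg S x ≤ 4) : ∃ x ∈ S, ∀ y ∈ S, x ≠ y → G.Adj x y := by
  obtain ⟨x, hx, hx'⟩ : ∃ x ∈ S, G.coDeg S x = 0 := by
    by_contra! h'
    have := Finset.card_nsmul_le_sum S (fun x => G.coDeg S x) 1 fun x hx =>
      Nat.one_le_iff_ne_zero.2 (h' x hx)
    simp only [smul_eq_mul, mul_one] at this
    omega
  refine ⟨x, hx, fun y hy hxy => ?_⟩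
  have := (Finset.sum_eq_zero_iff.1 hx') y hy
  by_contra hn
  simp [hxy, hn] at this

theorem sum_coDeg_erase_le {G : SimpleGraph V} {S : Finset V} (x : V) :
    ∑ z ∈ S.erase x, G.coDeg (S.erase x) z ≤ ∑ z ∈ S, G.coDeg S z :=
  (Finset.sum_le_sum fun _ _ => Finset.sum_le_sum_of_subset (Finset.erase_subset x S)).trans
    (Finset.sum_le_sum_of_subset (Finset.erase_subset x S))

/-- Two missing edges cannot meet all three perfect matchings of `K₄`. -/
theorem exists_matching {G : SimpleGraph V} {S : Finset V} (hcard : S.card = 4)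
    (h : ∑ x ∈ S, G.coDeg S x ≤ 4) : ∃ p ∈ S, ∃ q ∈ S, ∃ r ∈ S, ∃ s ∈ S,
      G.Adj p q ∧ G.Adj r s ∧ p ≠ r ∧ p ≠ s ∧ q ≠ r ∧ q ≠ s := by
  obtain ⟨p, T, hp, rfl, hT⟩ := Finset.card_eq_succ.1 hcard
  obtain ⟨q, r, s, hqr, hqs, hrs, rfl⟩ := Finset.card_eq_three.1 hT
  simp only [Finset.mem_insert, Finset.mem_singleton, not_or] at hp
  obtain ⟨hpq, hpr, hps⟩ := hp
  by_cases h₁ : G.Adj p q ∧ G.Adj r s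
  · exact ⟨p, by simp, q, by simp, r, by simp, s, by simp, h₁.1, h₁.2, hpr, hps, hqr, hqs⟩
  by_cases h₂ : G.Adj p r ∧ G.Adj q s
  · exact ⟨p, by simp, r, by simp, q, by simp, s, by simp, h₂.1, h₂.2, hpq, hps, hqr.symm, hrs⟩
  by_cases h₃ : G.Adj p s ∧ G.Adj q r
  · exact ⟨p, by simp, s, by simp, q, by simp, r, by simp, h₃.1, h₃.2, hpq, hpr, hqs.symm,
      hrs.symm⟩
  exfalso
  simp only [coDeg, Finset.sum_insert, Finset.sum_singleton, Finset.mem_insert,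
    Finset.mem_singleton, hpq, hpr, hps, hqr, hqs, hrs, hqr.symm, hqs.symm, hrs.symm, Ne.symm hpq,
    Ne.symm hpr, Ne.symm hps, G.adj_comm q p, G.adj_comm r p, G.adj_comm s p, G.adj_comm r q,
    G.adj_comm s q, G.adj_comm s r, not_false_eq_true, or_self, ne_eq, true_and, not_true_eq_false,
    false_and, if_false] at h
  split_ifs at h <;> first | omega | tauto

theorem hasButterfly_of_sum_coDeg_le {G : SimpleGraph V} {S : Finset V} (hcard : S.card = 5)
    (h : ∑ x ∈ S, G.coDeg S x ≤ 4) : ∃ c ∈ S, ∃ p ∈ S, ∃ q ∈ S, ∃ r ∈ S, ∃ s ∈ S,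
      IsButterfly G c p q r s := by
  obtain ⟨c, hc, hc'⟩ := exists_coDeg_eq_zero hcard.ge h
  obtain ⟨p, hp, q, hq, r, hr, s, hs, h₁, h₂, hne⟩ := exists_matching
    (by rw [Finset.card_erase_of_mem hc, hcard]) ((sum_coDeg_erase_le c).trans h)
  rw [Finset.mem_erase] at hp hq hr hs
  exact ⟨c, hc, p, hp.2, q, hq.2, r, hr.2, s, hs.2, hc' p hp.2 hp.1.symm, hc' q hq.2 hq.1.symm,
    hc' r hr.2 hr.1.symm, hc' s hs.2 hs.1.symm, h₁, h₂, hne⟩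

/-- A graph of order `6` with at least `13` edges contains `K₆ - C₄`. -/
theorem hasBook_of_sum_coDeg_le {G : SimpleGraph V} {S : Finset V} (hcard : S.card = 6)
    (h : ∑ x ∈ S, G.coDeg S x ≤ 4) : HasBook G := by
  obtain ⟨a, ha, ha'⟩ := exists_coDeg_eq_zero (by omega) h
  obtain ⟨b, hb, p, hp, q, hq, r, hr, s, hs, h₁, h₂, h₃, h₄, h₅, h₆, hne⟩ :=
    hasButterfly_of_sum_coDeg_le (by rw [Finset.card_erase_of_mem ha, hcard])
      ((sum_coDeg_erase_le a).trans h)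
  rw [Finset.mem_erase] at hb hp hq hr hs
  exact ⟨a, b, p, q, r, s, ha' b hb.2 hb.1.symm, ha' p hp.2 hp.1.symm, ha' q hq.2 hq.1.symm,
    ha' r hr.2 hr.1.symm, ha' s hs.2 hs.1.symm, h₁, h₂, h₃, h₄, h₅, h₆, hne⟩

end

variable {V : Type*} [Fintype V]

/-- A vertex outside a copy of `K₁ ∨ 2K₂` provides a free edge, unless it is the neighbour `u` of
`v`. Otherwise an edge between the two triangles is free, or `p`, `q`, `r`, `s` are all adjacent to
`u`; then `u` may replace `c`, which frees `cp`. -/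
theorem hasFreeEdge {G : SimpleGraph V} {S : Finset V} (hS : ∀ x ∉ S, G.deg x = 0) {v u : V}
    (hv : ∀ x, G.Adj v x ↔ x = u) (hmin : ∀ z ∈ S, z ≠ v → 3 ≤ G.deg z)
    (hB : HasButterfly G) : HasFreeEdge G v := by
  obtain ⟨c, p, q, r, s, hB⟩ := hB
  have hnv : ∀ {x y}, G.Adj x y → x ≠ u → v ≠ y := by
    intro x y e hx h
    subst h
    exact hx ((hv x).1 e.symm)
  have huv : v ≠ u := ((hv u).2 rfl).ne
  by_cases hout : ∃ w ∈ S, (w ≠ v ∧ w ≠ u) ∧ w ≠ c ∧ w ≠ p ∧ w ≠ q ∧ w ≠ r ∧ w ≠ s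
  · obtain ⟨w, hwS, ⟨nwv, nwu⟩, hw⟩ := hout
    obtain ⟨x, hwx, hx⟩ := exists_adj_notMem (hmin w hwS nwv) (T := {u}) (by simp)
    rw [Finset.mem_singleton] at hx
    exact ⟨w, x, hwx, nwv.symm, hnv hwx nwu, by simpa [hv], by simpa [hv],
      c, p, q, r, s, hB.sdiff_outer hw⟩
  have hall : ∀ w ∈ S, w ≠ v → w ≠ u → w = c ∨ w = p ∨ w = q ∨ w = r ∨ w = s := by
    intro w hwS nwv nwu
    by_contra! h
    exact hout ⟨w, hwS, ⟨nwv, nwu⟩, h⟩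
  -- The butterfly avoids `v`, which has only one neighbour.
  have hbv : ∀ {c p q r s}, IsButterfly G c p q r s → p ≠ v := by
    rintro c p q r s h rfl
    have h1 := (hv c).1 h.1.symm
    have h2 := (hv q).1 h.2.2.2.2.1
    exact h.2.1.ne (h1.trans h2.symm)
  -- A neighbour `z` of `p` other than `c` and `q` gives a free edge, unless `u` is `p` or `z`.
  have hcross : ∀ {p q r s}, IsButterfly G c p q r s → p ≠ u →
      (∃ z, G.Adj p z ∧ z ≠ c ∧ z ≠ q ∧ z ≠ u ∧ (z = r ∨ z = s)) → HasFreeEdge G v := by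
    rintro p q r s h npu ⟨z, hpz, -, -, nzu, rfl | rfl⟩
    · exact ⟨p, z, hpz, (hbv h).symm, hnv hpz npu, by simpa [hv], by simpa [hv],
        c, p, q, z, s, h.sdiff_cross⟩
    · exact ⟨p, z, hpz, (hbv h).symm, hnv hpz npu, by simpa [hv], by simpa [hv],
        c, p, q, z, r, h.swap_right.sdiff_cross⟩
  have hnb : ∀ {p q r s}, IsButterfly G c p q r s → p ≠ u →
      (∀ w ∈ S, w ≠ v → w ≠ u → w = c ∨ w = p ∨ w = q ∨ w = r ∨ w = s) →
      HasFreeEdge G v ∨ G.Adj p u ∧ u ≠ c ∧ u ≠ q := by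
    intro p q r s h npu hall
    obtain ⟨z, hpz, hz⟩ := exists_adj_notMem (hmin p (mem_of_deg_ne_zero hS h.1.symm) (hbv h))
      (T := {c, q}) (Finset.card_le_two.trans_lt (by simp))
    simp only [Finset.mem_insert, Finset.mem_singleton, not_or] at hz
    by_cases nzu : z = u
    · subst nzu
      exact .inr ⟨hpz, hz⟩
    · have h1 := hall z (mem_of_deg_ne_zero hS hpz.symm) (hnv hpz npu).symm nzu
      exact .inl (hcross h npu ⟨z, hpz, hz.1, hz.2, nzu, by
        have := hpz.ne'
        tauto⟩)
  by_contra hF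
  have hp := fun h => hnb hB h hall
  have hq := fun h => hnb hB.swap_left h fun w h1 h2 h3 => by
    have := hall w h1 h2 h3
    tauto
  have hr := fun h => hnb hB.swap h fun w h1 h2 h3 => by
    have := hall w h1 h2 h3
    tauto
  have hs := fun h => hnb hB.swap.swap_left h fun w h1 h2 h3 => by
    have := hall w h1 h2 h3
    tauto
  simp only [hF, false_or] at hp hq hr hs
  have npu : p ≠ u := by
    rintro rfl
    exact (hq hB.2.2.2.2.1.ne').2.2 rfl
  have nqu : q ≠ u := by
    rintro rfl
    exact (hp npu).2.2 rfl
  have nru : r ≠ u := by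
    rintro rfl
    exact (hs hB.2.2.2.2.2.1.ne').2.2 rfl
  have nsu : s ≠ u := by
    rintro rfl
    exact (hr nru).2.2 rfl
  obtain ⟨hpu, nuc, -⟩ := hp npu
  have hB' : IsButterfly G u p q r s := ⟨hpu.symm, (hq nqu).1.symm, (hr nru).1.symm,
    (hs nsu).1.symm, hB.2.2.2.2⟩
  refine hF ⟨c, p, hB.1, ?_, (hbv hB).symm, ?_, ?_, u, p, q, r, s, hB'.sdiff_outer
    ⟨nuc.symm, hB.1.ne, hB.2.1.ne, hB.2.2.1.ne, hB.2.2.2.1.ne⟩⟩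
  · exact hnv hB.1.symm npu
  · simpa [hv] using nuc.symm
  · simpa [hv] using npu

/-- Some graph with the degrees of `G` contains `K₁ ∨ 2K₂`. -/
def PotentiallyButterfly (G : SimpleGraph V) : Prop := ∃ G', SameDeg G G' ∧ HasButterfly G'

theorem PotentiallyButterfly.of_sameDeg {G G' : SimpleGraph V} (h : SameDeg G G')
    (h' : PotentiallyButterfly G') : PotentiallyButterfly G := by
  obtain ⟨G'', h1, h2⟩ := h'
  exact ⟨G'', h.trans h1, h2⟩

theorem potentiallyButterfly_of_isolate {G : SimpleGraph V} {v : V}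
    (h : PotentiallyButterfly (G.isolate v)) : PotentiallyButterfly G := by
  obtain ⟨G', hG', hB⟩ := h
  exact ⟨G'.attach G v, attach_sameDeg hG', hB.mono (le_attach G' G v)⟩

/-- Lift the pair `vx`, `vy` at a vertex `v` of degree `3`, delete `v`, find a butterfly in a graph
with the degrees of the rest, and put `v` back by subdividing a free edge. -/
theorem potentiallyButterfly_of_not_adj {G : SimpleGraph V} {S : Finset V}
    (hS : ∀ x ∉ S, G.deg x = 0) {v x y : V} (hv : G.deg v = 3)
    (hmin : ∀ z ∈ S, 3 ≤ G.deg z) (hx : G.Adj v x) (hy : G.Adj v y)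
    (hxy : ¬ G.Adj x y) (nxy : x ≠ y)
    (ih : ∀ G' : SimpleGraph V, G'.deg v = 0 → (∀ z, G'.deg z ≤ G.deg z) →
      ∑ z, G'.deg z + 4 = ∑ z, G.deg z → PotentiallyButterfly G') :
    PotentiallyButterfly G := by
  have h1 := lift_deg G hx hy hxy nxy
  set G₁ := G.lift v x y with hG₁
  have hv1 := h1 v
  have hi : ∀ i ≠ v, G₁.deg i = G.deg i := by
    intro i hi
    have := h1 i
    simpa [hi] using this
  have hsum : ∑ i, G₁.deg i + 2 = ∑ i, G.deg i := by
    simp_rw [← h1, Finset.sum_add_distrib]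
    simp
  have hsum' := sum_isolate_deg G₁ v
  rw [if_pos rfl] at hv1
  obtain ⟨G₂, hG₂, hB⟩ := ih (G₁.isolate v) (isolate_deg_self G₁ v) (fun i => by
    by_cases hiv : i = v
    · rw [hiv, isolate_deg_self]
      exact Nat.zero_le _
    · have := isolate_deg G₁ hiv
      have := hi i hiv
      omega) (by omega)
  have hsd := attach_sameDeg hG₂
  set G₃ := G₂.attach G₁ v
  have hv3 : G₃.deg v = 1 := by
    rw [hsd v]
    omega
  obtain ⟨u, hu⟩ := Finset.card_eq_one.1 hv3
  obtain ⟨a, b, hab, nva, nvb, hva, hvb, hB'⟩ := hasFreeEdge (G := G₃) (S := S) (v := v) (u := u)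
    (fun i hiS => by
      have h2 := hS i hiS
      have h3 : i ≠ v := by
        rintro rfl
        omega
      rw [hsd i, hi i h3, h2])
    (fun i => by rw [← mem_nbs, hu, Finset.mem_singleton])
    (fun i hiS hiv => by
      rw [hsd i, hi i hiv]
      exact hmin i hiS)
    (hB.mono (le_attach _ _ _))
  refine ⟨G₃.subdivide v a b, fun i => ?_, hB'.mono fun i j hij => ?_⟩
  · rw [subdivide_deg G₃ hab hva hvb nva nvb, hsd i, h1 i]
  · simp only [sdiff_adj] at hij
    simp only [subdivide, sup_adj, sdiff_adj]
    tauto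

theorem coDeg_add_deg {G : SimpleGraph V} {S : Finset V} (hS : ∀ x ∉ S, G.deg x = 0) {x : V}
    (hx : x ∈ S) : G.coDeg S x + G.deg x + 1 = S.card := by
  have h1 : ∑ y ∈ S, (if G.Adj x y then 1 else 0) = G.deg x := by
    rw [← Finset.card_filter, deg]
    congr 1
    ext y
    simp only [Finset.mem_filter, mem_nbs, and_iff_right_iff_imp]
    exact fun e => mem_of_deg_ne_zero hS e.symm
  have h2 : ∑ y ∈ S, (if x = y then 1 else 0) = 1 := by simp [hx]
  rw [← h1]
  nth_rw 2 [← h2]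
  rw [coDeg, ← Finset.sum_add_distrib, ← Finset.sum_add_distrib, Finset.card_eq_sum_ones]
  refine Finset.sum_congr rfl fun y _ => ?_
  by_cases hxy : x = y
  · subst hxy
    simp
  · by_cases h : G.Adj x y <;> simp [hxy, h]

end SimpleGraph

/-! ### Graphs with `2n - 2` edges -/

namespace SimpleGraph
open Classical
variable {V : Type*} [Fintype V]

theorem sum_deg_eq {G : SimpleGraph V} {S : Finset V} (hS : ∀ x ∉ S, G.deg x = 0) :
    ∑ x, G.deg x = ∑ x ∈ S, G.deg x :=
  (Finset.sum_subset (Finset.subset_univ S) fun x _ hx => hS x hx).symm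

theorem sum_coDeg_add_sum_deg {G : SimpleGraph V} {S : Finset V} (hS : ∀ x ∉ S, G.deg x = 0) :
    ∑ x ∈ S, G.coDeg S x + ∑ x, G.deg x + S.card = S.card * S.card := by
  have h : ∑ x ∈ S, (G.coDeg S x + G.deg x + 1) = ∑ x ∈ S, S.card :=
    Finset.sum_congr rfl fun x hx => coDeg_add_deg hS hx
  simpa [Finset.sum_add_distrib, ← sum_deg_eq hS] using h

/-- If a vertex `v` of degree `3` and its neighbours form a `K₄`, then an edge outside this `K₄`
either completes a copy of `K₁ ∨ 2K₂` or can be switched to separate two neighbours of `v`. -/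
theorem hasButterfly_or_exists_not_adj {G : SimpleGraph V} {v p q r x : V}
    (hv : ∀ z, G.Adj v z ↔ z = p ∨ z = q ∨ z = r) (hpq : G.Adj p q) (hpr : G.Adj p r)
    (hqr : G.Adj q r) (hvx : ¬ G.Adj v x) (nvx : v ≠ x) (hx : 3 ≤ G.deg x) :
    HasButterfly G ∨ ∃ G', SameDeg G G' ∧ ∃ a b, G'.Adj v a ∧ G'.Adj v b ∧ ¬ G'.Adj a b ∧
      a ≠ b := by
  have hvp := (hv p).2 (.inl rfl)
  have hvq := (hv q).2 (.inr (.inl rfl))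
  have hvr := (hv r).2 (.inr (.inr rfl))
  by_cases hB : HasButterfly G
  · exact .inl hB
  right
  -- Two neighbours of `v` with another common neighbour give a butterfly.
  have hbut : ∀ {p q r x}, G.Adj v p → G.Adj v r → G.Adj p q → G.Adj p r → q ≠ r → v ≠ q →
      ¬ G.Adj v x → v ≠ x → ¬ (G.Adj x p ∧ G.Adj x q) :=
    fun {p q r x} hvp hvr hpq hpr nqr nvq hvx nvx h => hB
      ⟨p, v, r, q, x, hvp.symm, hpr, hpq, h.1.symm, hvr, h.2.symm, nvq, nvx, nqr.symm,
        fun e => hvx (e ▸ hvr)⟩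
  have h₁ : ∀ {x}, ¬ G.Adj v x → v ≠ x → ¬ (G.Adj x p ∧ G.Adj x q) :=
    hbut hvp hvr hpq hpr hqr.ne hvq.ne
  have h₂ : ∀ {x}, ¬ G.Adj v x → v ≠ x → ¬ (G.Adj x p ∧ G.Adj x r) :=
    hbut hvp hvq hpr hpq hqr.ne' hvr.ne
  have h₃ : ∀ {x}, ¬ G.Adj v x → v ≠ x → ¬ (G.Adj x q ∧ G.Adj x r) :=
    hbut hvq hvp hqr hpq.symm hpr.ne' hvr.ne
  have hxv : ¬ G.Adj x v := fun e => hvx e.symm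
  have hsw : ∀ {n n' y}, G.Adj v n → G.Adj v n' → n ≠ n' → G.Adj x y → ¬ G.Adj v y →
      ¬ G.Adj n y → ¬ G.Adj x n' → ∃ G', SameDeg G G' ∧ ∃ a b, G'.Adj v a ∧ G'.Adj v b ∧
        ¬ G'.Adj a b ∧ a ≠ b := by
    intro n n' y hn hn' hne hxy hvy hny hxn'
    have nny : n ≠ y := fun e => hvy (e ▸ hn)
    refine ⟨G.switch v n x y, switch_sameDeg G hn hxy hvx hny nvx nny, x, n', ?_, ?_, ?_, ?_⟩
    · rw [switch_adj]
      exact .inr ⟨nvx, .inl ⟨rfl, rfl⟩⟩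
    · rw [switch_adj]
      have := hn.ne
      have := hn'.ne
      grind
    · rw [switch_adj]
      have := hn.ne
      have := hn'.ne
      have := hxy.ne
      grind
    · exact fun e => hvx (e ▸ hn')
  have hlt : (({p, q, r} : Finset V).filter (G.Adj x)).card < 3 := by
    refine lt_of_lt_of_le (Finset.card_lt_card (Finset.filter_ssubset.2 ?_))
      Finset.card_le_three
    by_cases hxp : G.Adj x p
    · exact ⟨q, by simp, fun e => h₁ hvx nvx ⟨hxp, e⟩⟩
    · exact ⟨p, by simp, hxp⟩
  obtain ⟨y, hxy, hy⟩ := exists_adj_notMem hx hlt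
  have hvy : ¬ G.Adj v y := fun e => hy (by simpa [hxy] using (hv y).1 e)
  have nvy : v ≠ y := fun e => hvx (e ▸ hxy).symm
  have hx₁ := h₁ hvx nvx
  have hx₂ := h₂ hvx nvx
  have hx₃ := h₃ hvx nvx
  have hy₁ := h₁ hvy nvy
  have hy₂ := h₂ hvy nvy
  obtain ⟨n, n', hn, hn', hne, hny, hxn'⟩ : ∃ n n', G.Adj v n ∧ G.Adj v n' ∧ n ≠ n' ∧
      ¬ G.Adj y n ∧ ¬ G.Adj x n' := by
    by_cases hyp : G.Adj y p
    · by_cases hxp : G.Adj x p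
      · exact ⟨q, r, hvq, hvr, hqr.ne, by tauto, by tauto⟩
      · exact ⟨q, p, hvq, hvp, hpq.ne', by tauto, hxp⟩
    · by_cases hxq : G.Adj x q
      · exact ⟨p, r, hvp, hvr, hpr.ne, hyp, by tauto⟩
      · exact ⟨p, q, hvp, hvq, hpq.ne, hyp, hxq⟩
  exact hsw hn hn' hne hxy hvy (fun e => hny e.symm) hxn'

/-- A graph of order `n ≥ 5` with at least `2n - 2` edges has the degrees of a graph containing
`K₁ ∨ 2K₂`. -/
theorem potentiallyButterfly {G : SimpleGraph V} {S : Finset V} (hS : ∀ x ∉ S, G.deg x = 0)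
    (hcard : 5 ≤ S.card) (hsum : 4 * S.card ≤ ∑ x, G.deg x + 4) : PotentiallyButterfly G := by
  obtain ⟨n, hn⟩ : ∃ n, S.card = n := ⟨_, rfl⟩
  rw [hn] at hcard
  induction n, hcard using Nat.le_induction generalizing S G with
  | base =>
    have := sum_coDeg_add_sum_deg hS
    rw [hn] at this hsum
    obtain ⟨c, -, p, -, q, -, r, -, s, -, h⟩ := hasButterfly_of_sum_coDeg_le hn
      (show ∑ x ∈ S, G.coDeg S x ≤ 4 by omega)
    exact ⟨G, .refl G, c, p, q, r, s, h⟩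
  | succ n hn5 ih =>
    obtain ⟨v, hvS, hmin⟩ := S.exists_min_image G.deg (Finset.card_pos.1 (by omega))
    have hcardv : (S.erase v).card = n := by rw [Finset.card_erase_of_mem hvS, hn]; rfl
    have hge : S.card * G.deg v ≤ ∑ x, G.deg x := by
      rw [sum_deg_eq hS]
      exact Finset.card_nsmul_le_sum S _ _ hmin
    have hsupp : ∀ {G' : SimpleGraph V}, G'.deg v = 0 → (∀ z, G'.deg z ≤ G.deg z) →
        ∀ x ∉ S.erase v, G'.deg x = 0 := by
      intro G' hv hle x hx
      by_cases hxv : x = v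
      · rwa [hxv]
      · have := hle x
        rw [hS x (fun h => hx (Finset.mem_erase.2 ⟨hxv, h⟩))] at this
        omega
    have hsumv := sum_isolate_deg G v
    rw [hn] at hsum hge
    by_cases hbig : 4 * (n + 1) + 2 * G.deg v ≤ ∑ x, G.deg x + 8
    · refine potentiallyButterfly_of_isolate (ih (S := S.erase v)
        (hsupp (isolate_deg_self G v) fun z => ?_) (by rw [hcardv]; omega) hcardv)
      by_cases hzv : z = v
      · rw [hzv, isolate_deg_self]
        exact Nat.zero_le _
      · have := isolate_deg G hzv
        omega
    have hd : G.deg v = 3 := by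
      have h1 : G.deg v < 4 := by
        by_contra! h
        nlinarith
      omega
    rw [hd] at hmin
    have hkey : ∀ {G' : SimpleGraph V}, SameDeg G G' → ∀ {a b}, G'.Adj v a → G'.Adj v b →
        ¬ G'.Adj a b → a ≠ b → PotentiallyButterfly G := by
      intro G' hG' a b ha hb hab nab
      refine PotentiallyButterfly.of_sameDeg hG' (potentiallyButterfly_of_not_adj (S := S)
        (fun x hx => (hG' x).trans (hS x hx)) ((hG' v).trans hd)
        (fun z hz => (hmin z hz).trans_eq (hG' z).symm) ha hb hab nab fun G'' hv hle hs => ?_)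
      have hs' : ∑ z, G'.deg z = ∑ z, G.deg z := Finset.sum_congr rfl fun z _ => hG' z
      exact ih (S := S.erase v) (hsupp hv fun z => (hle z).trans_eq (hG' z))
        (by rw [hcardv]; omega) hcardv
    obtain ⟨p, q, r, npq, npr, nqr, hN⟩ := Finset.card_eq_three.1 hd
    have hv : ∀ z, G.Adj v z ↔ z = p ∨ z = q ∨ z = r := by
      intro z
      rw [← mem_nbs, hN]
      simp
    by_cases hpq : G.Adj p q
    swap
    · exact hkey (.refl G) ((hv p).2 (by simp)) ((hv q).2 (by simp)) hpq npq
    by_cases hpr : G.Adj p r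
    swap
    · exact hkey (.refl G) ((hv p).2 (by simp)) ((hv r).2 (by simp)) hpr npr
    by_cases hqr : G.Adj q r
    swap
    · exact hkey (.refl G) ((hv q).2 (by simp)) ((hv r).2 (by simp)) hqr nqr
    obtain ⟨x, hxS, hx⟩ := Finset.exists_mem_notMem_of_card_lt_card
      (s := {v, p, q, r}) (t := S) (Finset.card_le_four.trans_lt (by omega))
    simp only [Finset.mem_insert, Finset.mem_singleton, not_or] at hx
    rcases hasButterfly_or_exists_not_adj hv hpq hpr hqr
      (show ¬ G.Adj v x by rw [hv]; tauto) (Ne.symm hx.1) (hmin x hxS) with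
      h | ⟨G', hG', a, b, ha, hb, hab, nab⟩
    · exact ⟨G, .refl G, h⟩
    · exact hkey hG' ha hb hab nab

end SimpleGraph

/-! ### Two graphs of small order -/

namespace SimpleGraph

/-- The degrees in terms of Mathlib's `degree`, for any instance. -/
theorem deg_eq_degree {V : Type*} [Fintype V] (G : SimpleGraph V) (v : V)
    [Fintype (G.neighborSet v)] : G.deg v = G.degree v := by
  rw [deg, ← card_neighborFinset_eq_degree]
  congr 1
  ext
  simp

/-- The graph on `W` whose non-edges are listed, each in either direction, in `L`. -/
def ofNonedges {W : Type*} (L : List (W × W)) : SimpleGraph W where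
  Adj i j := i ≠ j ∧ (i, j) ∉ L ∧ (j, i) ∉ L
  symm := ⟨fun _ _ h => ⟨h.1.symm, h.2.2, h.2.1⟩⟩
  loopless := ⟨fun _ h => h.1 rfl⟩

instance {W : Type*} [DecidableEq W] (L : List (W × W)) : DecidableRel (ofNonedges L).Adj :=
  fun i j => inferInstanceAs (Decidable (i ≠ j ∧ (i, j) ∉ L ∧ (j, i) ∉ L))

/-- The complement of two disjoint 4-cycles, a `5`-regular graph of order `8`. -/
abbrev exhibitEight : SimpleGraph (Fin 8) :=
  ofNonedges [(0, 1), (1, 2), (2, 3), (3, 0), (4, 5), (5, 6), (6, 7), (7, 4)]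

/-- A graph of order `9` in which the vertex `3` has degree `6` and the others have degree `5`: the
complement of the 4-cycle `0123`, the stars from `7` and from `8` to `4`, `5`, `6`, and a matching
of `0`, `1`, `2` to `4`, `5`, `6`. -/
abbrev exhibitNine : SimpleGraph (Fin 9) :=
  ofNonedges [(0, 1), (1, 2), (2, 3), (3, 0), (0, 4), (1, 5), (2, 6), (7, 4), (7, 5), (7, 6),
    (8, 4), (8, 5), (8, 6)]

theorem hasBook_exhibitEight : HasBook exhibitEight :=
  ⟨4, 6, 0, 2, 1, 3, by decide⟩

theorem deg_exhibitEight (i : Fin 8) : exhibitEight.deg i = 5 := by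
  rw [deg_eq_degree]
  revert i
  decide

theorem hasBook_exhibitNine : HasBook exhibitNine :=
  ⟨7, 8, 0, 2, 1, 3, by decide⟩

theorem deg_exhibitNine (i : Fin 9) : exhibitNine.deg i = if i = 3 then 6 else 5 := by
  rw [deg_eq_degree]
  revert i
  decide

end SimpleGraph

/-! ### Graphs with `3n - 5` edges -/

namespace SimpleGraph
open Classical

theorem deg_map {V W : Type*} [Fintype V] [Fintype W] (H : SimpleGraph W) (f : W ↪ V) (i : W) :
    (H.map f).deg (f i) = H.deg i := by
  have : (H.map f).nbs (f i) = (H.nbs i).map f := by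
    ext x
    simp only [mem_nbs, map_adj, Finset.mem_map, f.injective.eq_iff]
    grind
  rw [deg, this, Finset.card_map]
  rfl

theorem HasBook.map {V W : Type*} {H : SimpleGraph W} (h : HasBook H) (f : W ↪ V) :
    HasBook (H.map f) := by
  obtain ⟨a, b, p, q, r, s, h⟩ := h
  exact ⟨f a, f b, f p, f q, f r, f s, by simpa using h⟩

/-- A copy of `K₆ - C₄` may be sought in any graph with the same degrees apart from zeros. -/
theorem HasBook.potentiallyBook {V W : Type*} [Fintype V] [Fintype W] {H : SimpleGraph W}
    (h : HasBook H) {G : SimpleGraph V} (f : W ↪ V) (hdeg : ∀ i, G.deg (f i) = H.deg i)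
    (hf : ∀ x ∉ Set.range f, G.deg x = 0) : PotentiallyBook G := by
  refine ⟨H.map f, fun x => ?_, h.map f⟩
  by_cases hx : x ∈ Set.range f
  · obtain ⟨i, rfl⟩ := hx
    rw [deg_map, hdeg]
  · rw [hf x hx, deg, Finset.card_eq_zero, Finset.eq_empty_iff_forall_notMem]
    intro y hy
    obtain ⟨i, j, -, rfl, -⟩ := (map_adj f H x y).1 (mem_nbs.1 hy)
    exact hx ⟨i, rfl⟩

variable {V : Type*} [Fintype V]

theorem potentiallyBook_of_card_eq_eight {G : SimpleGraph V} {S : Finset V}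
    (hS : ∀ x ∉ S, G.deg x = 0) (hcard : S.card = 8) (hmin : ∀ x ∈ S, 5 ≤ G.deg x)
    (hsum : ∑ x, G.deg x = 40) : PotentiallyBook G := by
  have h5 : ∀ x ∈ S, 5 = G.deg x :=
    (Finset.sum_eq_sum_iff_of_le hmin).1 (by rw [← sum_deg_eq hS, hsum]; simp [hcard])
  have e := S.equivFinOfCardEq hcard
  refine hasBook_exhibitEight.potentiallyBook (e.symm.toEmbedding.trans (.subtype _))
    (fun i => ?_) fun x hx => hS x fun h => hx ⟨e ⟨x, h⟩, by simp⟩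
  rw [deg_exhibitEight]
  exact (h5 _ (e.symm i).2).symm

theorem potentiallyBook_of_card_eq_nine {G : SimpleGraph V} {S : Finset V}
    (hS : ∀ x ∉ S, G.deg x = 0) (hcard : S.card = 9) (hmin : ∀ x ∈ S, 5 ≤ G.deg x)
    (hsum : ∑ x, G.deg x = 46) : PotentiallyBook G := by
  rw [sum_deg_eq hS] at hsum
  obtain ⟨w, hw, hw5⟩ : ∃ w ∈ S, 5 < G.deg w := by
    by_contra! h
    have := Finset.sum_le_card_nsmul S _ _ h
    rw [hcard, hsum, smul_eq_mul] at this
    omega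
  have hcard' : (S.erase w).card = 8 := by rw [Finset.card_erase_of_mem hw, hcard]
  have hmin' : ∀ x ∈ S.erase w, 5 ≤ G.deg x := fun x hx => hmin x (Finset.mem_of_mem_erase hx)
  have h1 : (S.erase w).card • 5 ≤ ∑ x ∈ S.erase w, G.deg x :=
    Finset.card_nsmul_le_sum _ _ _ hmin'
  have h2 : G.deg w + ∑ x ∈ S.erase w, G.deg x = ∑ x ∈ S, G.deg x := Finset.add_sum_erase S _ hw
  rw [hcard', smul_eq_mul] at h1
  have h5 : ∀ x ∈ S.erase w, 5 = G.deg x :=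
    (Finset.sum_eq_sum_iff_of_le hmin').1 (by simp [hcard']; omega)
  -- The vertex of degree `6` is to be the vertex `3` of the model.
  have e₀ := S.equivFinOfCardEq hcard
  obtain ⟨e, he⟩ : ∃ e : S ≃ Fin 9, e ⟨w, hw⟩ = 3 :=
    ⟨e₀.trans (Equiv.swap (e₀ ⟨w, hw⟩) 3), by simp⟩
  refine hasBook_exhibitNine.potentiallyBook (e.symm.toEmbedding.trans (.subtype _))
    (fun i => ?_) fun x hx => hS x fun h => hx ⟨e ⟨x, h⟩, by simp⟩
  rw [deg_exhibitNine]
  change G.deg (e.symm i) = _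
  split_ifs with hi
  · rw [hi, ← he, Equiv.symm_apply_apply]
    change G.deg w = 6
    omega
  · refine (h5 _ (Finset.mem_erase.2 ⟨fun h => hi ?_, (e.symm i).2⟩)).symm
    rw [← he, ← e.symm_apply_eq]
    exact Subtype.ext h

theorem even_sum_deg (G : SimpleGraph V) : Even (∑ x, G.deg x) := by
  simp_rw [deg_eq_degree]
  exact ⟨_, (G.sum_degrees_eq_twice_card_edges).trans (two_mul _)⟩

theorem adj_of_deg_add_one_eq_card {G : SimpleGraph V} {S : Finset V} (hS : ∀ x ∉ S, G.deg x = 0)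
    {c x : V} (hc : c ∈ S) (hdom : G.deg c + 1 = S.card) (hx : x ∈ S) (hcx : c ≠ x) :
    G.Adj c x := by
  have h0 : G.coDeg S c = 0 := by
    have := coDeg_add_deg hS hc
    omega
  have := (Finset.sum_eq_zero_iff.1 h0) x hx
  by_contra hn
  simp [hcx, hn] at this

/-- With a vertex `c` adjacent to all others, it suffices to find `K₁ ∨ 2K₂` after deleting `c`. -/
theorem potentiallyBook_of_dominating {G : SimpleGraph V} {S : Finset V}
    (hS : ∀ x ∉ S, G.deg x = 0) (hcard : 6 ≤ S.card) (hsum : 6 * S.card ≤ ∑ x, G.deg x + 10)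
    {c : V} (hc : c ∈ S) (hdom : G.deg c + 1 = S.card) : PotentiallyBook G := by
  have hcardc : (S.erase c).card + 1 = S.card := Finset.card_erase_add_one hc
  have hsumc := sum_isolate_deg G c
  have hS' : ∀ x ∉ S.erase c, (G.isolate c).deg x = 0 := by
    intro x hx
    by_cases hxc : x = c
    · rw [hxc, isolate_deg_self]
    · have := isolate_deg G hxc
      rw [hS x (fun h => hx (Finset.mem_erase.2 ⟨hxc, h⟩))] at this
      omega
  obtain ⟨G', hG', z, p, q, r, s, hB⟩ := potentiallyButterfly hS' (by omega) (by omega)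
  have hc' : ∀ {x y}, G'.Adj x y → (G'.attach G c).Adj c x := by
    intro x y hxy
    have := mem_of_deg_ne_zero (S := S.erase c) (fun x hx => (hG' x).trans (hS' x hx)) hxy
    rw [Finset.mem_erase] at this
    exact .inr ⟨adj_of_deg_add_one_eq_card hS hc hdom this.2 this.1.symm, .inl rfl⟩
  have hle := le_attach G' G c
  obtain ⟨h₁, h₂, h₃, h₄, h₅, h₆, hne⟩ := hB
  exact ⟨_, attach_sameDeg hG', c, z, p, q, r, s, hc' h₁, hc' h₁.symm, hc' h₂.symm, hc' h₃.symm,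
    hc' h₄.symm, hle h₁, hle h₂, hle h₃, hle h₄, hle h₅, hle h₆, hne⟩

/-- A graph of order `n ≥ 6` with at least `3n - 5` edges has the degrees of a graph containing
`K₆ - C₄`. -/
theorem potentiallyBook {G : SimpleGraph V} {S : Finset V} (hS : ∀ x ∉ S, G.deg x = 0)
    (hcard : 6 ≤ S.card) (hsum : 6 * S.card ≤ ∑ x, G.deg x + 10) : PotentiallyBook G := by
  obtain ⟨n, hn⟩ : ∃ n, S.card = n := ⟨_, rfl⟩
  rw [hn] at hcard
  induction n, hcard using Nat.le_induction generalizing S G with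
  | base =>
    have := sum_coDeg_add_sum_deg hS
    rw [hn] at this hsum
    exact ⟨G, .refl G, hasBook_of_sum_coDeg_le hn (by omega)⟩
  | succ n hn6 ih =>
    obtain ⟨v, hvS, hmin⟩ := S.exists_min_image G.deg (Finset.card_pos.1 (by omega))
    have hcardv : (S.erase v).card = n := by rw [Finset.card_erase_of_mem hvS, hn]; rfl
    have hge : S.card * G.deg v ≤ ∑ x, G.deg x := by
      rw [sum_deg_eq hS]
      exact Finset.card_nsmul_le_sum S _ _ hmin
    have hsupp : ∀ {G' : SimpleGraph V}, G'.deg v = 0 → (∀ z, G'.deg z ≤ G.deg z) →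
        ∀ x ∉ S.erase v, G'.deg x = 0 := by
      intro G' hv hle x hx
      by_cases hxv : x = v
      · rwa [hxv]
      · have := hle x
        rw [hS x (fun h => hx (Finset.mem_erase.2 ⟨hxv, h⟩))] at this
        omega
    have hsumv := sum_isolate_deg G v
    by_cases hbig : 6 * (n + 1) + 2 * G.deg v ≤ ∑ x, G.deg x + 16
    · refine potentiallyBook_of_isolate (ih (S := S.erase v)
        (hsupp (isolate_deg_self G v) fun z => ?_) (by rw [hcardv]; omega) hcardv)
      by_cases hzv : z = v
      · rw [hzv, isolate_deg_self]
        exact Nat.zero_le _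
      · have := isolate_deg G hzv
        omega
    -- A lift at `v`, in any graph with the degrees of `G`, reduces the order.
    have hred : (G.deg v = 4 ∨ G.deg v = 5) → Reducible G v →
        (∀ G' : SimpleGraph V, (∀ z ≠ v, G'.deg z = G.deg z) → G.deg v = G'.deg v + 4 →
          HasBook G' → HasFreePairs G' v) → PotentiallyBook G := by
      rintro hd ⟨G', hG', hB | hL⟩ hF
      · exact ⟨G', hG', hB⟩
      have hs' : ∑ z, G'.deg z = ∑ z, G.deg z := Finset.sum_congr rfl fun z _ => hG' z
      refine .of_sameDeg hG' (potentiallyBook_of_hasLift hL (fun G'' hv hle hs => ?_)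
        fun G'' hne hv hB => hF G'' (fun z hz => (hne z hz).trans (hG' z))
          ((hG' v).symm.trans hv) hB)
      rw [hG' v, hs'] at hs
      exact ih (S := S.erase v) (hsupp hv fun z => (hle z).trans_eq (hG' z))
        (by rw [hcardv]; omega) hcardv
    have hd : G.deg v = 4 ∨ G.deg v = 5 := by
      rw [hn] at hge hsum
      have h1 : G.deg v < 6 := by
        by_contra! h
        nlinarith
      omega
    rcases hd with hd | hd
    · rw [hd] at hmin
      by_cases hdom : ∃ c ∈ S, G.deg c + 1 = S.card
      · obtain ⟨c, hc, hdom⟩ := hdom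
        exact potentiallyBook_of_dominating hS (by omega) hsum hc hdom
      push Not at hdom
      refine hred (.inl hd) (reducible_of_deg_eq_four hS hmin (by omega) hdom hd)
        fun G' hne hv hB => ?_
      have hv0 : G'.deg v = 0 := by omega
      have hmin' : ∀ z ∈ S, z ≠ v → 4 ≤ G'.deg z := fun z hz hzv =>
        (hmin z hz).trans_eq (hne z hzv).symm
      have hS' : ∀ x ∉ S, G'.deg x = 0 := fun x hx =>
        (hne x fun e => hx (e ▸ hvS)).trans (hS x hx)
      obtain h7 | h8 | h9 : n = 6 ∨ n = 7 ∨ 8 ≤ n := by omega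
      · exact hasFreePairs_of_card_eq_seven hS' hvS hv0 hmin' (by omega) hB
      · refine hasFreePairs_of_card_eq_eight hS' hvS hv0 hmin' (by omega) ?_ hB
        have h1 : ∑ z, (G'.deg z + if z = v then 4 else 0) = ∑ z, G.deg z := by
          refine Finset.sum_congr rfl fun z _ => ?_
          split_ifs with hz
          · rw [hz, hv]
          · exact hne z hz
        simp only [Finset.sum_add_distrib, Finset.sum_ite_eq', Finset.mem_univ, if_true] at h1
        omega
      · exact hasFreePairs_of_card (S := S) (fun z hz hzv => by rw [hv0]; exact hmin' z hz hzv)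
          (by omega) hB
    · rw [hd] at hmin hge hbig
      rw [hn] at hge hsum
      obtain ⟨m, hm⟩ := even_sum_deg G
      obtain h8 | h9 | h10 : n = 7 ∨ n = 8 ∨ 9 ≤ n := by omega
      · exact potentiallyBook_of_card_eq_eight hS (by omega) hmin (by omega)
      · exact potentiallyBook_of_card_eq_nine hS (by omega) hmin (by omega)
      · refine hred (.inr hd) (reducible_of_deg_eq_five (S := S) hmin (by omega) hd)
          fun G' hne hv hB => hasFreePairs_of_card (S := S) (fun z hz hzv => ?_) (by omega) hB
        have := hmin z hz
        rw [hne z hzv]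
        omega

end SimpleGraph

/-! ### The sequence `((n-1)³, 3ⁿ⁻³)` -/

namespace SimpleGraph

theorem k6MinusC4_eq : K6MinusC4 = ofNonedges [(0, 1), (1, 2), (2, 3), (3, 0)] := by
  ext i j
  simp only [K6MinusC4, sdiff_adj, top_adj, map_adj]
  revert i j
  decide

theorem HasBook.isContained {V : Type*} {G : SimpleGraph V} (h : HasBook G) :
    K6MinusC4.IsContained G := by
  obtain ⟨a, b, p, q, r, s, h₁, h₂, h₃, h₄, h₅, h₆, h₇, h₈, h₉, h₁₀, h₁₁, hpr, hps, hqr, hqs⟩ := h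
  rw [k6MinusC4_eq]
  refine ⟨⟨![p, r, q, s, a, b], fun {i j} hij => ?_⟩, fun i j hij => ?_⟩
  · fin_cases i <;> fin_cases j <;> first
      | exact absurd hij (by decide)
      | simp [*, h₁.symm, h₂.symm, h₃.symm, h₄.symm, h₅.symm, h₆.symm, h₇.symm, h₈.symm, h₉.symm,
          h₁₀.symm, h₁₁.symm]
  · refine List.nodup_ofFn.1 ?_ hij
    simp [hpr, hps, hqr.symm, hqs, h₂.ne', h₃.ne', h₄.ne', h₅.ne',
      h₆.ne', h₇.ne', h₈.ne', h₉.ne', h₁.ne, h₁₀.ne, h₁₁.ne]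

/-- `K₆ - C₄` has no independent set of order `3`. -/
theorem exists_k6MinusC4_adj (T : Finset (Fin 6)) (hT : 3 ≤ T.card) :
    ∃ i ∈ T, ∃ j ∈ T, K6MinusC4.Adj i j := by
  rw [k6MinusC4_eq]
  revert T
  decide

/-- The join `K₃ ∨ (n - 3)K₁`. -/
def extremalGraph (n : ℕ) : SimpleGraph (Fin n) where
  Adj i j := i ≠ j ∧ ((i : ℕ) < 3 ∨ (j : ℕ) < 3)
  symm := ⟨fun _ _ h => ⟨h.1.symm, h.2.symm⟩⟩
  loopless := ⟨fun _ h => h.1 rfl⟩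

theorem isRealization_extremalGraph {n : ℕ} (hn : 3 ≤ n) :
    IsRealization (extremalGraph n) (extremalSeq n) := by
  intro i
  rw [← deg_eq_degree, deg, extremalSeq]
  split_ifs with hi
  · have : (extremalGraph n).nbs i = Finset.univ.erase i := by
      ext j
      simp [extremalGraph, hi, eq_comm]
    rw [this, Finset.card_erase_of_mem (Finset.mem_univ i), Finset.card_fin]
  · have : (extremalGraph n).nbs i = Finset.univ.map (Fin.castLEEmb hn) := by
      ext j
      simp only [mem_nbs, extremalGraph, Finset.mem_map, Finset.mem_univ, true_and, hi, false_or]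
      constructor
      · exact fun h => ⟨⟨j, h.2⟩, rfl⟩
      · rintro ⟨k, rfl⟩
        exact ⟨fun e => hi (e ▸ k.2), k.2⟩
    rw [this, Finset.card_map, Finset.card_fin]

theorem antitone_extremalSeq {n : ℕ} (hn : 4 ≤ n) : Antitone (extremalSeq n) := by
  intro i j hij
  have : (i : ℕ) ≤ j := hij
  unfold extremalSeq
  split_ifs <;> omega

theorem isGraphic_extremalSeq {n : ℕ} (hn : 4 ≤ n) : IsGraphic (extremalSeq n) :=
  ⟨antitone_extremalSeq hn, extremalGraph n, isRealization_extremalGraph (by omega)⟩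

theorem extremalSeq_pos {n : ℕ} (hn : 2 ≤ n) (i : Fin n) : 0 < extremalSeq n i := by
  unfold extremalSeq
  split_ifs <;> omega

theorem sum_extremalSeq {n : ℕ} (hn : 3 ≤ n) :
    ((∑ i, extremalSeq n i : ℕ) : ℤ) = 6 * (n : ℤ) - 12 := by
  obtain ⟨m, rfl⟩ := Nat.exists_eq_add_of_le hn
  rw [Fin.sum_univ_add]
  simp [extremalSeq]
  ring

/-- In a realization of `((n-1)³, 3ⁿ⁻³)` the vertices of degree `3` form an independent set. -/
theorem not_adj_of_isRealization {n : ℕ} {G : SimpleGraph (Fin n)}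
    (hG : IsRealization G (extremalSeq n)) {i j : Fin n} (hi : 3 ≤ (i : ℕ)) (hj : 3 ≤ (j : ℕ)) :
    ¬ G.Adj i j := by
  intro hij
  have hdeg : ∀ k, G.deg k = extremalSeq n k := fun k => by
    classical exact (deg_eq_degree G k).trans (hG k)
  have hn : 3 ≤ n := by omega
  have hsub : insert j (Finset.univ.map (Fin.castLEEmb hn)) ⊆ G.nbs i := by
    intro x hx
    rw [Finset.mem_insert, Finset.mem_map] at hx
    rw [mem_nbs]
    rcases hx with rfl | ⟨k, -, rfl⟩
    · exact hij
    · have hk : ((Fin.castLEEmb hn k : Fin n) : ℕ) < 3 := k.2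
      refine (adj_of_deg_add_one_eq_card (S := Finset.univ) (by simp) (Finset.mem_univ _) ?_
        (Finset.mem_univ i) fun e => ?_).symm
      · rw [hdeg, extremalSeq, if_pos hk, Finset.card_fin]
        omega
      · rw [e] at hk
        omega
  have h1 := Finset.card_le_card hsub
  rw [Finset.card_insert_of_notMem, Finset.card_map, Finset.card_fin] at h1
  · have h2 := hdeg i
    rw [extremalSeq, if_neg (by omega)] at h2
    rw [deg] at h2
    omega
  · rintro hmem
    obtain ⟨k, -, rfl⟩ := Finset.mem_map.1 hmem
    exact absurd k.2 hj.not_gt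

theorem not_isPotentiallyGraphic_extremalSeq (n : ℕ) :
    ¬ IsPotentiallyGraphic K6MinusC4 (extremalSeq n) := by
  rintro ⟨-, G, hG, ⟨f⟩⟩
  have hcard : 3 ≤ (Finset.univ.filter fun i => 3 ≤ (f i : ℕ)).card := by
    have h1 : (Finset.univ.filter fun i => ¬ 3 ≤ (f i : ℕ)).card ≤ (Finset.range 3).card :=
      Finset.card_le_card_of_injOn (fun i => (f i : ℕ)) (fun i hi => by simpa using hi)
        fun i _ j _ h => f.injective (Fin.ext h)
    have h2 := Finset.card_filter_add_card_filter_not (s := (Finset.univ : Finset (Fin 6)))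
      fun i => 3 ≤ (f i : ℕ)
    simp only [Finset.card_fin, Finset.card_range] at h1 h2
    omega
  obtain ⟨i, hi, j, hj, hij⟩ := exists_k6MinusC4_adj _ hcard
  rw [Finset.mem_filter] at hi hj
  exact not_adj_of_isRealization hG hi.2 hj.2 (f.toHom.map_adj hij)

theorem isPotentiallyGraphic_k6MinusC4 {n : ℕ} (hn : 6 ≤ n) {d : Fin n → ℕ} (hd : IsGraphic d)
    (hsum : 6 * n ≤ ∑ i, d i + 10) : IsPotentiallyGraphic K6MinusC4 d := by
  obtain ⟨hanti, G, hG⟩ := hd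
  have hdeg : ∀ k, G.deg k = d k := fun k => by
    classical exact (deg_eq_degree G k).trans (hG k)
  obtain ⟨G', hG', hB⟩ := potentiallyBook (G := G) (S := Finset.univ) (by simp) (by simpa)
    (by simpa [hdeg])
  classical
  exact ⟨hanti, G', fun i => (deg_eq_degree G' i).symm.trans ((hG' i).trans (hdeg i)),
    hB.isContained⟩

end SimpleGraph

theorem mainTheorem2 (n : ℕ) (hn : 6 ≤ n) :
    IsSigma K6MinusC4 n (6 * (n : ℤ) - 10) ∧
    IsGraphic (extremalSeq n) ∧ (∀ i, 0 < extremalSeq n i) ∧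
    ((∑ i, extremalSeq n i : ℕ) : ℤ) = 6 * (n : ℤ) - 12 ∧
    ¬ IsPotentiallyGraphic K6MinusC4 (extremalSeq n) := by
  have hg := SimpleGraph.isGraphic_extremalSeq (n := n) (by omega)
  have hpos := SimpleGraph.extremalSeq_pos (n := n) (by omega)
  have hsum := SimpleGraph.sum_extremalSeq (n := n) (by omega)
  have hnot := SimpleGraph.not_isPotentiallyGraphic_extremalSeq n
  refine ⟨⟨⟨⟨3 * n - 5, by ring⟩, fun d hd _ hs => ?_⟩, fun s ⟨hs, h⟩ => ?_⟩, hg, hpos, hsum, hnot⟩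
  · exact SimpleGraph.isPotentiallyGraphic_k6MinusC4 hn hd (by omega)
  · -- An even number less than `6n - 10` is at most the sum `6n - 12` of the extremal sequence.
    by_contra hlt
    obtain ⟨t, rfl⟩ := hs
    exact hnot (h _ hg hpos (by omega))
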